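/- Let $\mathcal I$ be an inverse category, i.e. a category with a degree function $\deg\colon \mathrm{ob}\,\mathcal I\to\mathbb N$ such that $\deg i>\deg j$ for every non-identity map $i\to j$, and suppose that every underslice $i/\mathcal I$ has finitely many objects (for instance, $\mathcal I$ is finite). Write $\partial(i/\mathcal I)$ for the full subcategory of $i/\mathcal I$ on the non-identity maps. Let $\mathbf C$ be a finitely complete category. Let $\mathcal I$ and $\mathbf C$ each be equipped with a wide subcategory of weak equivalences that contains all isomorphisms and satisfies 2-out-of-3, and let $\mathbf C$ be equipped with a pullback-stable wide subcategory of fibrations. For $p\colon B\to A$ and $K$ over $B$, a pushforward of $K$ along $p$ is an object $p_*K$ over $A$ with a map $\mathrm{ev}\colon p^*p_*K\to K$ over $B$ such that for each $X$ over $A$, the assignment $t\mapsto \mathrm{ev}\circ p^*t$ is a bijection from maps $X\to p_*K$ over $A$ to maps $p^*X\to K$ over $B$. Assume: * pushforwards in $\mathbf C$ of fibrations along fibrations exist and are fibrations; * weak equivalences are preserved by pullback along fibrations, and for every map $f\colon A'\to A$ the functor $f^*\colon\mathbf C/A\to\mathbf C/A'$ preserves weak equivalences between fibrations; * for every fibration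 $p$, the pushforward $p_*$ sends weak equivalences between fibrations over its source to weak equivalences; * for every commutative square $f p'=p g$ with $p\colon B\to A$, $p'\colon B'\to A'$ fibrations and $f\colon A'\to A$, $g\colon B'\to B$ weak equivalences, and every fibration $K\to B$, the comparison map $f^*p_*K\to p'_*g^*K$, i.e. the transpose of $p'^*f^*p_*K\cong g^*p^*p_*K\xrightarrow{g^*\mathrm{ev}}g^*K$, is a weak equivalence. For $X\in\mathbf C^{\mathcal I}$ let $M_iX=\lim(\partial(i/\mathcal I)\to\mathcal I\xrightarrow{X}\mathbf C)$. A Reedy fibration is a map $q\colon E\to B$ in $\mathbf C^{\mathcal I}$ such that for each $i$ the relative matching map $E_i\to B_i\times_{M_iB}M_iE$ is a fibration. A diagram is homotopical if it preserves weak equivalences, and a homotopical Reedy fibration is a Reedy fibration between homotopical diagrams. Suppose that for each $i\in\mathcal I$ and each non-identity weak equivalence $w\colon i\to j$, either all maps out of $i$ are weak equivalences or $w$ is an initial object of $\partial(i/\mathcal I)$. Then for all homotopical Reedy fibrations $p\colon B\to A$ and $k\colon K\to B$ in $\mathbf C^{\mathcal I}$, a pushforward of $k$ along $p$ in $\mathbf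 C^{\mathcal I}$ exists, and every such pushforward $p_*K\to A$ is a homotopical Reedy fibration. -/

import Mathlib

open CategoryTheory CategoryTheory.Limits

universe v₁ v₂ u₁ u₂

namespace InverseDiagrams

section InverseCategories

variable (I : Type u₁) [Category.{v₁} I]

/-- A category is *inverse* if its objects can be graded by natural numbers in such a way that
every non-identity morphism strictly decreases the degree. -/
def IsInverseCategory : Prop :=
  ∃ deg : I → ℕ, ∀ ⦃i j : I⦄ (f : i ⟶ j),
    ¬ MorphismProperty.identities I f → deg j < deg i

variable {I}

/-- The objects of the under category `i/I` that are different from the identity of `i`. -/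
def boundaryProp (i : I) : ObjectProperty (Under i) :=
  fun f => ¬ MorphismProperty.identities I f.hom

/-- The boundary `∂(i/I)`: the full subcategory of `i/I` on the non-identity morphisms. -/
abbrev Boundary (i : I) := (boundaryProp i).FullSubcategory

/-- A non-identity morphism `f : i ⟶ j`, as an object of `∂(i/I)`. -/
def Boundary.mk {i j : I} (f : i ⟶ j) (hf : ¬ MorphismProperty.identities I f) : Boundary i :=
  ⟨Under.mk f, hf⟩

instance finite_boundary (i : I) [Finite (Under i)] : Finite (Boundary i) :=
  Finite.of_injective (fun f : Boundary i => f.obj) (by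
    rintro ⟨f, hf⟩ ⟨g, hg⟩ h
    cases h
    rfl)

/-- If all under categories of `I` are finite, then so are the hom sets of `∂(i/I)`. -/
instance finite_boundary_hom [∀ i : I, Finite (Under i)] (i : I) (f g : Boundary i) :
    Finite (f ⟶ g) := by
  have h : Function.Injective
      (fun a : f ⟶ g => (Under.mk a.hom.right : Under f.obj.right)) := by
    intro a b hab
    apply ObjectProperty.hom_ext
    apply Under.UnderMorphism.ext
    have h : ∀ {x y : Under f.obj.right} (e : x = y), HEq x.hom y.hom := by
      rintro x _ rfl
      rfl
    exact eq_of_heq (h hab)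
  exact Finite.of_injective _ h

variable {C : Type u₂} [Category.{v₂} C]

/-- A category with finite limits has limits indexed by categories with finitely many objects
and finite hom sets, in whatever universes these live. -/
theorem hasLimitsOfShape_of_finite (J : Type u₁) [Category.{v₁} J] [Finite J]
    [∀ j j' : J, Finite (j ⟶ j')] [HasFiniteLimits C] : HasLimitsOfShape J C := by
  obtain ⟨n, ⟨e⟩⟩ := Finite.exists_equiv_fin J
  let K := InducedCategory J e.symm
  have hfin : ∀ a b : K, Finite (a ⟶ b) := fun a b =>
    Finite.of_injective (fun f : a ⟶ b => f.hom) (fun f g h => by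
      apply InducedCategory.hom_ext; exact h)
  have : LocallySmall.{0} K := ⟨fun a b => inferInstance⟩
  have hK : Finite (ShrinkHoms.{0} K) := Finite.of_equiv (Fin n) (Equiv.refl (Fin n))
  have : ∀ a b : ShrinkHoms.{0} K, Finite (a ⟶ b) := fun a b =>
    Finite.of_injective (equivShrink (ShrinkHoms.fromShrinkHoms a ⟶
      ShrinkHoms.fromShrinkHoms b)).symm (Equiv.injective _)
  let : FinCategory (ShrinkHoms.{0} K) :=
    { fintypeObj := Fintype.ofFinite _
      fintypeHom := fun a b => Fintype.ofFinite _ }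
  have : (inducedFunctor e.symm).EssSurj :=
    ⟨fun j => ⟨e j, ⟨eqToIso (e.symm_apply_apply j)⟩⟩⟩
  have : (inducedFunctor e.symm).IsEquivalence := { }
  have : HasLimitsOfShape (ShrinkHoms.{0} K) C := inferInstance
  have : HasLimitsOfShape K C :=
    hasLimitsOfShape_of_equivalence (ShrinkHoms.equivalence.{0} K).symm
  exact hasLimitsOfShape_of_equivalence (inducedFunctor e.symm).asEquivalence

instance hasLimitsOfShape_boundary [HasFiniteLimits C] [∀ i : I, Finite (Under i)] (i : I) :
    HasLimitsOfShape (Boundary i) C :=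
  hasLimitsOfShape_of_finite (Boundary i)

end InverseCategories

section Reedy

variable {I : Type u₁} [Category.{v₁} I] {C : Type u₂} [Category.{v₂} C]

/-- The composite `∂(i/I) ⥤ I ⥤ C`. -/
abbrev boundaryDiagram (X : I ⥤ C) (i : I) : Boundary i ⥤ C :=
  ((boundaryProp i).ι ⋙ Under.forget i) ⋙ X

variable [HasFiniteLimits C] [∀ i : I, Finite (Under i)]

/-- The matching object `M_i X`, the limit of `X` over `∂(i/I)`. -/
noncomputable def matchingObj (X : I ⥤ C) (i : I) : C :=
  limit (boundaryDiagram X i)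

/-- The projection `M_i X ⟶ X_j` at a non-identity morphism `f : i ⟶ j`. -/
noncomputable def matchingProj (X : I ⥤ C) (i : I) (f : Boundary i) :
    matchingObj X i ⟶ X.obj f.obj.right :=
  limit.π (boundaryDiagram X i) f

/-- The cone over `boundaryDiagram X i` with apex `X_i` and components `X_f` for `f : i ⟶ j`. -/
def boundaryCone (X : I ⥤ C) (i : I) : Cone (boundaryDiagram X i) where
  pt := X.obj i
  π :=
    { app := fun f => X.map f.obj.hom
      naturality := fun f g a => by
        have h : f.obj.hom ≫ a.hom.right = g.obj.hom := Under.w a.hom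
        exact (Category.id_comp _).trans (by rw [← h]; exact X.map_comp _ _) }

/-- The matching map `m_i X : X_i ⟶ M_i X`, whose component at `f : i ⟶ j` is `X_f`. -/
noncomputable def matchingMap (X : I ⥤ C) (i : I) : X.obj i ⟶ matchingObj X i :=
  limit.lift (boundaryDiagram X i) (boundaryCone X i)

/-- The map `M_i f : M_i X ⟶ M_i Y` induced by a map of diagrams. -/
noncomputable def matchingObjMap {X Y : I ⥤ C} (f : X ⟶ Y) (i : I) :
    matchingObj X i ⟶ matchingObj Y i :=
  limMap (Functor.whiskerLeft ((boundaryProp i).ι ⋙ Under.forget i) f)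

theorem matchingMap_proj (X : I ⥤ C) (i : I) (f : Boundary i) :
    matchingMap X i ≫ matchingProj X i f = X.map f.obj.hom :=
  limit.lift_π (boundaryCone X i) f

theorem matchingObjMap_proj {X Y : I ⥤ C} (a : X ⟶ Y) (i : I) (f : Boundary i) :
    matchingObjMap a i ≫ matchingProj Y i f = matchingProj X i f ≫ a.app f.obj.right :=
  limMap_π _ f

theorem matchingMap_naturality {X Y : I ⥤ C} (a : X ⟶ Y) (i : I) :
    a.app i ≫ matchingMap Y i = matchingMap X i ≫ matchingObjMap a i := by
  refine limit.hom_ext fun f => ?_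
  change (a.app i ≫ matchingMap Y i) ≫ matchingProj Y i f =
    (matchingMap X i ≫ matchingObjMap a i) ≫ matchingProj Y i f
  rw [Category.assoc, Category.assoc, matchingMap_proj, matchingObjMap_proj,
    ← Category.assoc, matchingMap_proj]
  exact (a.naturality f.obj.hom).symm

/-- The relative matching map `E_i ⟶ B_i ×_{M_i B} M_i E` of a map of diagrams `p : E ⟶ B`. -/
noncomputable def relativeMatchingMap {E B : I ⥤ C} (p : E ⟶ B) (i : I) :
    E.obj i ⟶ pullback (matchingMap B i) (matchingObjMap p i) :=
  pullback.lift (p.app i) (matchingMap E i) (matchingMap_naturality p i)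

/-- A map of diagrams is a *Reedy fibration* if all its relative matching maps are fibrations. -/
def IsReedyFibration (F : MorphismProperty C) {E B : I ⥤ C} (p : E ⟶ B) : Prop :=
  ∀ i : I, F (relativeMatchingMap p i)

/-- A diagram is *homotopical* if it sends weak equivalences to weak equivalences. -/
def IsHomotopical (WI : MorphismProperty I) (W : MorphismProperty C) (X : I ⥤ C) : Prop :=
  ∀ ⦃i j : I⦄ (w : i ⟶ j), WI w → W (X.map w)

/-- A *homotopical Reedy fibration* is a Reedy fibration between homotopical diagrams. -/
structure IsHomotopicalReedyFibration (WI : MorphismProperty I) (F W : MorphismProperty C)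
    {E B : I ⥤ C} (p : E ⟶ B) : Prop where
  reedy : IsReedyFibration F p
  source : IsHomotopical WI W E
  target : IsHomotopical WI W B

end Reedy

section Pushforwards

variable {D : Type u₂} [Category.{v₂} D] [HasPullbacks D]

/-- `P`, together with the evaluation map `ev : p^* P ⟶ K` over `B`, is a *pushforward* `p_* K` of
`K` along `p : B ⟶ A`: for each `X` over `A`, transposition along `ev` is a bijection from maps
`X ⟶ P` over `A` to maps `p^* X ⟶ K` over `B`. -/
def IsPushforward {A B : D} (p : B ⟶ A) (K : Over B) (P : Over A)
    (ev : (Over.pullback p).obj P ⟶ K) : Prop :=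
  ∀ (X : Over A) (u : (Over.pullback p).obj X ⟶ K),
    ∃! t : X ⟶ P, (Over.pullback p).map t ≫ ev = u

/-- Pushforwards of fibrations along fibrations exist and are fibrations. -/
structure FibrationsStableUnderPushforward (F : MorphismProperty D) : Prop where
  exists_pushforward : ∀ ⦃A B : D⦄ (p : B ⟶ A) (K : Over B), F p → F K.hom →
    ∃ (P : Over A) (ev : (Over.pullback p).obj P ⟶ K), IsPushforward p K P ev
  fibration : ∀ ⦃A B : D⦄ (p : B ⟶ A) (K : Over B) (P : Over A)
    (ev : (Over.pullback p).obj P ⟶ K), F p → F K.hom → IsPushforward p K P ev → F P.hom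

/-- For a commutative square with sides `p' : B' ⟶ A'`, `f : A' ⟶ A`, `g : B' ⟶ B`, `p : B ⟶ A`,
and `ev : p^* P ⟶ K` over `B`, this is the map `g^* ev : p'^* f^* P ≅ g^* p^* P ⟶ g^* K`
over `B'`. -/
noncomputable def pulledBackEv {A B A' B' : D} {p : B ⟶ A} {p' : B' ⟶ A'} {f : A' ⟶ A}
    {g : B' ⟶ B} (comm : p' ≫ f = g ≫ p) {K : Over B} {P : Over A}
    (ev : (Over.pullback p).obj P ⟶ K) :
    (Over.pullback p').obj ((Over.pullback f).obj P) ⟶ (Over.pullback g).obj K :=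
  Over.homMk
    (pullback.lift
      (pullback.lift
          (pullback.fst (pullback.snd P.hom f) p' ≫ pullback.fst P.hom f)
          (pullback.snd (pullback.snd P.hom f) p' ≫ g)
          (by rw [Category.assoc, Category.assoc, pullback.condition, ← comm,
                pullback.condition_assoc]) ≫ ev.left)
      (pullback.snd (pullback.snd P.hom f) p')
      (by
        have h : ev.left ≫ K.hom = pullback.snd P.hom p := Over.w ev
        rw [Category.assoc, h, pullback.lift_snd]))
    (pullback.lift_snd _ _ _)

/-- Weak equivalences are preserved by pullback along fibrations, and pullbacks preserve weak
equivalences between fibrations. -/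
structure PullbacksLogicallyBehaved (F W : MorphismProperty D) : Prop where
  along_fibration : ∀ ⦃X Y Z T : D⦄ (fst : T ⟶ X) (snd : T ⟶ Y) (q : X ⟶ Z) (w : Y ⟶ Z),
    IsPullback fst snd q w → F q → W w → W fst
  between_fibrations : ∀ ⦃A A' : D⦄ (f : A' ⟶ A) (E E' : Over A) (u : E ⟶ E'),
    F E.hom → F E'.hom → W u.left → W ((Over.pullback f).map u).left

/-- Pushforwards along fibrations preserve weak equivalences between fibrations, and for a
commutative square whose sides `p`, `p'` are fibrations and whose other sides `g`, `f` are weak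
equivalences, the comparison map `f^* p_* K ⟶ p'_* g^* K` (the transpose of `g^* ev`) is a weak
equivalence for each fibration `K` over `B`. -/
structure PushforwardsLogicallyBehaved (F W : MorphismProperty D) : Prop where
  between_fibrations : ∀ ⦃A B : D⦄ (p : B ⟶ A) (K K' : Over B) (u : K ⟶ K')
    (P P' : Over A) (ev : (Over.pullback p).obj P ⟶ K) (ev' : (Over.pullback p).obj P' ⟶ K')
    (t : P ⟶ P'),
    F p → F K.hom → F K'.hom → W u.left →
    IsPushforward p K P ev → IsPushforward p K' P' ev' →
    (Over.pullback p).map t ≫ ev' = ev ≫ u → W t.left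
  precomposition : ∀ ⦃A B A' B' : D⦄ (p : B ⟶ A) (p' : B' ⟶ A') (f : A' ⟶ A) (g : B' ⟶ B)
    (comm : p' ≫ f = g ≫ p) (K : Over B) (P : Over A) (P' : Over A')
    (ev : (Over.pullback p).obj P ⟶ K)
    (ev' : (Over.pullback p').obj P' ⟶ (Over.pullback g).obj K)
    (t : (Over.pullback f).obj P ⟶ P'),
    F p → F p' → W f → W g → F K.hom →
    IsPushforward p K P ev → IsPushforward p' ((Over.pullback g).obj K) P' ev' →
    (Over.pullback p').map t ≫ ev' = pulledBackEv comm ev → W t.left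

end Pushforwards

end InverseDiagrams

/-!
The idea is to describe the value `P i` of a pushforward of `k : K ⟶ B` along `p : B ⟶ A` by a
universal property not involving the other values: maps `X ⟶ P i` over `A i` correspond to lifts
through `k` of the diagram `f ↦ X ×_{A j} B j` on `i/I`, where `f : i ⟶ j`. For a cosieve `S` of
maps out of `i`, consider more generally the lifts defined on `S` only. If `S` is enlarged by one
map `f : i ⟶ j`, extending a lift from `S` to `f` is lifting a map into `B j ×_{M_j B} M_j K`
through the relative matching map of `k` at `j`. Hence the lifts on the larger cosieve are
represented by a pushforward of a pullback of this fibration along a pullback of `p j`, and as `i/I`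
is finite, `P i` is reached in finitely many steps.

The lifts on the boundary `∂(i/I)` are represented by `A i ×_{M_i A} M_i P`, so the last step
exhibits the relative matching map of `P` at `i` as a pushforward of a fibration; hence `P ⟶ A` is a
Reedy fibration.

Let `w : i ⟶ j` be a non-identity weak equivalence. If all maps out of `i` are weak equivalences,
then so are the maps `X ×_{A i} B i ⟶ X ×_{A j} B j`, and replacing the diagram by the constant one
at `X ×_{A i} B i` compares `P i` with the pushforward of `K i` along `p i`; the same holds at `j`,
and these pushforwards are compared along `w` by hypothesis. If instead `w` is initial in
`∂(i/I)`, then for a map `E ⟶ D` with `D w` a weak equivalence, `E w` is one if and only if the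
relative matching map at `i` is. This transfers from `k` to `P ⟶ A` because pushforwards preserve
weak equivalences between fibrations.
-/

namespace InverseDiagrams

/-! ### Universal lifts -/

section UniversalLifts

variable {𝒜 : Type*} [Category 𝒜] {C : Type u₂} [Category.{v₂} C]

/-- `r : P ⟶ T` with `ε : G P ⟶ K` is a *universal lift* of `n : G T ⟶ N` through `m : K ⟶ N` if
maps `X ⟶ P` over `T` correspond to lifts through `m` of the restriction of `n` to `G X`. When
`G X` is the fibre product of `X` with a fixed map, this says that `P` is the pushforward of the
pullback of `m` along `n`. -/
structure IsUniversalLift (G : 𝒜 ⥤ C) {T P : 𝒜} {N K : C} (n : G.obj T ⟶ N) (m : K ⟶ N)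
    (r : P ⟶ T) (ε : G.obj P ⟶ K) : Prop where
  fac : ε ≫ m = G.map r ≫ n
  existsUnique : ∀ ⦃X : 𝒜⦄ (a : X ⟶ T) (u : G.obj X ⟶ K), u ≫ m = G.map a ≫ n →
    ∃! t : X ⟶ P, t ≫ r = a ∧ G.map t ≫ ε = u

namespace IsUniversalLift

variable {G : 𝒜 ⥤ C} {T P : 𝒜} {N K : C} {n : G.obj T ⟶ N} {m : K ⟶ N} {r : P ⟶ T}
  {ε : G.obj P ⟶ K}

theorem hom_ext (h : IsUniversalLift G n m r ε) {X : 𝒜} {t t' : X ⟶ P} (hr : t ≫ r = t' ≫ r)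
    (hε : G.map t ≫ ε = G.map t' ≫ ε) : t = t' :=
  (h.existsUnique (t' ≫ r) (G.map t' ≫ ε) (by simp [h.fac])).unique ⟨hr, hε⟩ ⟨rfl, rfl⟩

theorem baseChange (h : IsUniversalLift G n m r ε) {T' P' : 𝒜} {c : T' ⟶ T} {c' : P' ⟶ P}
    {r' : P' ⟶ T'} (sq : IsPullback c' r' r c) :
    IsUniversalLift G (G.map c ≫ n) m r' (G.map c' ≫ ε) where
  fac := by simp only [Category.assoc, h.fac, ← G.map_comp_assoc, sq.w]
  existsUnique X a u hu := by
    obtain ⟨t, ⟨htr, htε⟩, -⟩ := h.existsUnique (a ≫ c) u (by simpa using hu)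
    refine ⟨sq.lift t a htr, ⟨by simp, by simp [← G.map_comp_assoc, htε]⟩, ?_⟩
    rintro s ⟨hsr, hsε⟩
    refine sq.hom_ext (h.hom_ext ?_ ?_) (by simp [hsr])
    · simp only [Category.assoc, sq.w, reassoc_of% hsr, IsPullback.lift_fst, htr]
    · simpa [htε] using hsε

theorem id (n : G.obj T ⟶ N) : IsUniversalLift G n (𝟙 N) (𝟙 T) n where
  fac := by simp
  existsUnique X a u hu := ⟨a, ⟨by simp, by simpa using hu.symm⟩, fun t ht => by simpa using ht.1⟩

end IsUniversalLift

end UniversalLifts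

section Pushforwards

/-- The maps `q X : G X ⟶ X` exhibit `G X` as the fibre product of `X` with a fixed map. -/
def IsCartesianFamily {C : Type u₂} [Category.{v₂} C] {A : C} {G : Over A ⥤ C}
    (q : ∀ X : Over A, G.obj X ⟶ X.left) : Prop :=
  ∀ ⦃X T : Over A⦄ (a : X ⟶ T), IsPullback (G.map a) (q X) (q T) a.left

theorem IsCartesianFamily.of_isPullback {C : Type u₂} [Category.{v₂} C] {A A' B' : C}
    {G : Over A ⥤ C} {q : ∀ X : Over A, G.obj X ⟶ X.left} {s : ∀ X : Over A, G.obj X ⟶ B'}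
    {c : A ⟶ A'} {π : B' ⟶ A'} (sq : ∀ X, IsPullback (q X) (s X) (X.hom ≫ c) π)
    (hq : ∀ ⦃X T : Over A⦄ (a : X ⟶ T), G.map a ≫ q T = q X ≫ a.left)
    (hs : ∀ ⦃X T : Over A⦄ (a : X ⟶ T), G.map a ≫ s T = s X) : IsCartesianFamily q := by
  intro X T a
  refine IsPullback.of_right ?_ (hq a) (sq T).flip
  rw [hs a, Over.w_assoc]
  exact (sq X).flip

variable {C : Type u₂} [Category.{v₂} C] [HasPullbacks C] {A : C} {G : Over A ⥤ C}
  {q : ∀ X : Over A, G.obj X ⟶ X.left} {T : Over A} {N K : C} {n : G.obj T ⟶ N} {m : K ⟶ N}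
  {K' : Over (G.obj T)} {top : K'.left ⟶ K}

theorem over_pullback_hom_ext {B Z Z' : C} {p : B ⟶ A} {x : Z' ⟶ A}
    {f g : Z ⟶ ((Over.pullback p).obj (Over.mk x)).left}
    (hfst : f ≫ pullback.fst x p = g ≫ pullback.fst x p)
    (hsnd : f ≫ ((Over.pullback p).obj (Over.mk x)).hom =
      g ≫ ((Over.pullback p).obj (Over.mk x)).hom) : f = g :=
  pullback.hom_ext hfst hsnd

namespace IsCartesianFamily

/-- `G X` as the pullback of `G T` along `X ⟶ T`. -/
noncomputable def fibreIso (hq : IsCartesianFamily q) {X : Over A} (a : X ⟶ T) :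
    G.obj X ≅ ((Over.pullback (q T)).obj (Over.mk a.left)).left :=
  (hq a).flip.isoPullback

theorem fibreIso_hom_comp_hom (hq : IsCartesianFamily q) {X : Over A} (a : X ⟶ T) :
    (hq.fibreIso a).hom ≫ ((Over.pullback (q T)).obj (Over.mk a.left)).hom = G.map a :=
  (hq a).flip.isoPullback_hom_snd

theorem fibreIso_hom_comp_fst (hq : IsCartesianFamily q) {X : Over A} (a : X ⟶ T) :
    (hq.fibreIso a).hom ≫ pullback.fst a.left (q T) = q X :=
  (hq a).flip.isoPullback_hom_fst

theorem fibreIso_hom_naturality (hq : IsCartesianFamily q) {X P : Over A} {a : X ⟶ T} {r : P ⟶ T}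
    (t : X ⟶ P) (t' : Over.mk a.left ⟶ Over.mk r.left) (ht : t.left = t'.left) :
    (hq.fibreIso a).hom ≫ ((Over.pullback (q T)).map t').left =
      G.map t ≫ (hq.fibreIso r).hom := by
  have hta : t ≫ r = a := Over.OverMorphism.ext ((congr_arg (· ≫ r.left) ht).trans (Over.w t'))
  apply over_pullback_hom_ext
  · have hfst : ((Over.pullback (q T)).map t').left ≫ pullback.fst r.left (q T) =
        pullback.fst a.left (q T) ≫ t.left := ht ▸ pullback.lift_fst _ _ _
    simp only [Category.assoc, hfst, fibreIso_hom_comp_fst,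
      reassoc_of% hq.fibreIso_hom_comp_fst a, (hq t).w]
  · simp only [Category.assoc, Over.w, fibreIso_hom_comp_hom, ← G.map_comp, hta]

/-- The map `G X ⟶ K` corresponding to a map into the pullback `K'` of `K ⟶ N` along
`G T ⟶ N`. -/
noncomputable def transpose (hq : IsCartesianFamily q) (top : K'.left ⟶ K) {X : Over A} (a : X ⟶ T)
    (v : (Over.pullback (q T)).obj (Over.mk a.left) ⟶ K') : G.obj X ⟶ K :=
  (hq.fibreIso a).hom ≫ v.left ≫ top

theorem transpose_comp (hq : IsCartesianFamily q) (w : top ≫ m = K'.hom ≫ n) {X : Over A}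
    (a : X ⟶ T) (v : (Over.pullback (q T)).obj (Over.mk a.left) ⟶ K') :
    hq.transpose top a v ≫ m = G.map a ≫ n := by
  simp only [transpose, Category.assoc, w, Over.w_assoc, reassoc_of% hq.fibreIso_hom_comp_hom a]

theorem transpose_injective (hq : IsCartesianFamily q) (sq : IsPullback top K'.hom m n) {X : Over A}
    (a : X ⟶ T) : Function.Injective (hq.transpose top a) := fun v v' h =>
  Over.OverMorphism.ext <| sq.hom_ext ((cancel_epi (hq.fibreIso a).hom).1 h) <| by
    rw [Over.w, Over.w]

theorem exists_transpose_eq (hq : IsCartesianFamily q) (sq : IsPullback top K'.hom m n) {X : Over A}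
    (a : X ⟶ T) {u : G.obj X ⟶ K} (hu : u ≫ m = G.map a ≫ n) :
    ∃ v, hq.transpose top a v = u := by
  have hw : ((hq.fibreIso a).inv ≫ u) ≫ m =
      ((Over.pullback (q T)).obj (Over.mk a.left)).hom ≫ n := by
    rw [Category.assoc, hu, Iso.inv_comp_eq, reassoc_of% hq.fibreIso_hom_comp_hom a]
  refine ⟨Over.homMk (sq.lift _ _ hw) (sq.lift_snd _ _ _), ?_⟩
  simp only [transpose, Over.homMk_left, IsPullback.lift_fst, Iso.hom_inv_id_assoc]

theorem transpose_map_comp (hq : IsCartesianFamily q) {X P : Over A} {a : X ⟶ T} {r : P ⟶ T}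
    (t : X ⟶ P) (t' : Over.mk a.left ⟶ Over.mk r.left) (ht : t.left = t'.left)
    (ev : (Over.pullback (q T)).obj (Over.mk r.left) ⟶ K') :
    hq.transpose top a ((Over.pullback (q T)).map t' ≫ ev) =
      G.map t ≫ hq.transpose top r ev := by
  simp only [transpose, Over.comp_left, Category.assoc]
  rw [reassoc_of% hq.fibreIso_hom_naturality t t' ht]

theorem isUniversalLift_transpose_iff (hq : IsCartesianFamily q) (sq : IsPullback top K'.hom m n)
    {P : Over A} {r : P ⟶ T} {ev : (Over.pullback (q T)).obj (Over.mk r.left) ⟶ K'} :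
    IsUniversalLift G n m r (hq.transpose top r ev) ↔
      IsPushforward (q T) K' (Over.mk r.left) ev := by
  constructor
  · intro h X v
    let a : Over.mk (X.hom ≫ T.hom) ⟶ T := Over.homMk X.hom
    obtain ⟨t, ⟨htr, htv⟩, ht⟩ := h.existsUnique a (hq.transpose top a v)
      (hq.transpose_comp sq.w a v)
    refine ⟨Over.homMk t.left (congr_arg (·.left) htr), ?_, fun s hs => ?_⟩
    · exact hq.transpose_injective sq a ((hq.transpose_map_comp t _ rfl ev).trans htv)
    · have hsX : s.left ≫ r.left = X.hom := Over.w s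
      let s' : Over.mk (X.hom ≫ T.hom) ⟶ P :=
        Over.homMk s.left (by rw [← Over.w r, reassoc_of% hsX]; rfl)
      have hs' : s' = t := ht s' ⟨Over.OverMorphism.ext hsX,
        (hq.transpose_map_comp (a := a) s' s rfl ev).symm.trans (congr_arg _ hs)⟩
      exact Over.OverMorphism.ext (congr_arg (·.left) hs')
  · refine fun h => ⟨hq.transpose_comp sq.w r ev, fun X a u hu => ?_⟩
    obtain ⟨v, rfl⟩ := hq.exists_transpose_eq sq a hu
    obtain ⟨t, htv, ht⟩ := h (Over.mk a.left) v
    have hta : t.left ≫ r.left = a.left := Over.w t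
    let t' : X ⟶ P := Over.homMk t.left (by rw [← Over.w r, reassoc_of% hta, Over.w])
    refine ⟨t', ⟨Over.OverMorphism.ext hta,
      (hq.transpose_map_comp t' t rfl ev).symm.trans (congr_arg _ htv)⟩, ?_⟩
    rintro s ⟨hsr, hsv⟩
    let s' : Over.mk a.left ⟶ Over.mk r.left := Over.homMk s.left (congr_arg (·.left) hsr)
    have hs' : s' = t := ht s' <| hq.transpose_injective sq a <|
      (hq.transpose_map_comp s s' rfl ev).trans hsv
    exact Over.OverMorphism.ext (congr_arg (·.left) hs')

end IsCartesianFamily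

end Pushforwards

section Fibrations

variable {C : Type u₂} [Category.{v₂} C] [HasPullbacks C] {F : MorphismProperty C} {A : C}
  {G : Over A ⥤ C} {q : ∀ X : Over A, G.obj X ⟶ X.left} {T P : Over A} {N K : C}
  {n : G.obj T ⟶ N} {m : K ⟶ N} {r : P ⟶ T} {ε : G.obj P ⟶ K}

/-- Every map from a value of `G` admits a universal lift through every fibration, and it is again a
fibration. -/
def LiftsFibrations (F : MorphismProperty C) (G : Over A ⥤ C) : Prop :=
  ∀ ⦃T : Over A⦄ ⦃N K : C⦄ (n : G.obj T ⟶ N) (m : K ⟶ N), F m →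
    ∃ (P : Over A) (r : P ⟶ T) (ε : G.obj P ⟶ K), IsUniversalLift G n m r ε ∧ F r.left

namespace IsUniversalLift

theorem exists_transpose_eq (h : IsUniversalLift G n m r ε) (hq : IsCartesianFamily q)
    {K' : Over (G.obj T)} {top : K'.left ⟶ K} (sq : IsPullback top K'.hom m n) :
    ∃ ev : (Over.pullback (q T)).obj (Over.mk r.left) ⟶ K',
      IsPushforward (q T) K' (Over.mk r.left) ev ∧ hq.transpose top r ev = ε := by
  obtain ⟨ev, rfl⟩ := hq.exists_transpose_eq sq r h.fac
  exact ⟨ev, (hq.isUniversalLift_transpose_iff sq).1 h, rfl⟩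

theorem fibration [F.IsStableUnderBaseChange] (h : IsUniversalLift G n m r ε)
    (hq : IsCartesianFamily q) (hF : FibrationsStableUnderPushforward F) (hqT : F (q T))
    (hm : F m) : F r.left := by
  obtain ⟨ev, hev, -⟩ := h.exists_transpose_eq hq (K' := Over.mk (pullback.snd m n))
    (IsPullback.of_hasPullback m n)
  exact hF.fibration (q T) _ _ ev hqT (F.pullback_snd m n hm) hev

end IsUniversalLift

theorem IsCartesianFamily.liftsFibrations [F.IsStableUnderBaseChange] (hq : IsCartesianFamily q)
    (hF : FibrationsStableUnderPushforward F) (hFq : ∀ X, F (q X)) : LiftsFibrations F G := by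
  intro T N K n m hm
  obtain ⟨P, ev, hev⟩ := hF.exists_pushforward (q T) (Over.mk (pullback.snd m n)) (hFq T)
    (F.pullback_snd m n hm)
  let r : Over.mk (P.hom ≫ T.hom) ⟶ T := Over.homMk P.hom
  have h := (hq.isUniversalLift_transpose_iff (r := r) (IsPullback.of_hasPullback m n)).2 hev
  exact ⟨_, r, _, h, h.fibration hq hF (hFq T) hm⟩

end Fibrations

/-! ### Weak equivalences between universal lifts -/

section WeakEquivalences

variable {C : Type u₂} [Category.{v₂} C] [HasPullbacks C] {F W : MorphismProperty C}
  [W.HasTwoOutOfThreeProperty] {A : C}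
  {G G' : Over A ⥤ C} {q : ∀ X : Over A, G.obj X ⟶ X.left} {q' : ∀ X : Over A, G'.obj X ⟶ X.left}
  {T P P' : Over A} {N N' K K' : C}

theorem IsUniversalLift.weakEquivalence_of_map [F.IsStableUnderBaseChange]
    (hq : IsCartesianFamily q)
    (hpb : PullbacksLogicallyBehaved F W) (hpf : PushforwardsLogicallyBehaved F W) (hqT : F (q T))
    {n : G.obj T ⟶ N} {n' : G.obj T ⟶ N'} {m : K ⟶ N} {m' : K' ⟶ N'} {r : P ⟶ T} {r' : P' ⟶ T}
    {ε : G.obj P ⟶ K} {ε' : G.obj P' ⟶ K'}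
    (h : IsUniversalLift G n m r ε) (h' : IsUniversalLift G n' m' r' ε') (hm : F m) (hm' : F m')
    {u : K ⟶ K'} {v : N ⟶ N'} (hu : W u) (hv : W v) (huv : u ≫ m' = m ≫ v) (hn : n ≫ v = n')
    {t : P ⟶ P'} (ht : t ≫ r' = r) (htε : G.map t ≫ ε' = ε ≫ u) : W t.left := by
  subst hn
  let c : Over.mk m ⟶ Over.mk (pullback.snd m' v) :=
    Over.homMk (pullback.lift u m huv) (pullback.lift_snd _ _ _)
  have hcu : c.left ≫ pullback.fst m' v = u := pullback.lift_fst _ _ _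
  have hc : W c.left := W.of_postcomp _ (pullback.fst m' v)
    (hpb.along_fibration _ _ _ _ (IsPullback.of_hasPullback m' v) hm' hv)
    (by rwa [hcu])
  let φ := (Over.pullback n).map c
  have hφ : φ.left ≫ pullback.fst (pullback.snd m' v) n = pullback.fst m n ≫ c.left :=
    pullback.lift_fst _ _ _
  have sq := IsPullback.of_hasPullback m n
  have sq' := (IsPullback.of_hasPullback (pullback.snd m' v) n).paste_horiz
    (IsPullback.of_hasPullback m' v)
  obtain ⟨ev, hev, rfl⟩ := h.exists_transpose_eq hq
    (K' := (Over.pullback n).obj (Over.mk m)) sq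
  obtain ⟨ev', hev', rfl⟩ := h'.exists_transpose_eq hq
    (K' := (Over.pullback n).obj (Over.mk (pullback.snd m' v))) sq'
  have hm'v := F.pullback_snd m' v hm'
  let t' : Over.mk r.left ⟶ Over.mk r'.left := Over.homMk t.left (congr_arg (·.left) ht)
  refine hpf.between_fibrations (q T) _ _ φ _ _ ev ev' t' hqT (F.pullback_snd m n hm)
    (F.pullback_snd _ n hm'v) (hpb.between_fibrations n _ _ c hm hm'v hc) hev hev' ?_
  refine hq.transpose_injective sq' r ((hq.transpose_map_comp t t' rfl ev').trans ?_)
  rw [htε]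
  simp only [IsCartesianFamily.transpose, Over.comp_left, Category.assoc, reassoc_of% hφ, hcu]

theorem IsUniversalLift.weakEquivalence_of_weakEquivalence [F.IsMultiplicative]
    [F.IsStableUnderBaseChange] (hq : IsCartesianFamily q)
    (hW : MorphismProperty.isomorphisms C ≤ W)
    (hpb : PullbacksLogicallyBehaved F W) (hpf : PushforwardsLogicallyBehaved F W) (hqT : F (q T))
    {n : G.obj T ⟶ N} {m : K ⟶ N} {r : P ⟶ T} {ε : G.obj P ⟶ K}
    (h : IsUniversalLift G n m r ε) (hm : F m) (hmW : W m) : W r.left :=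
  h.weakEquivalence_of_map hq hpb hpf hqT (IsUniversalLift.id n) hm (F.id_mem N) hmW
    (hW _ (inferInstanceAs (IsIso (𝟙 N)))) rfl (Category.comp_id n) (Category.comp_id r) h.fac.symm

/-- `κ` is compatible with the projections of the families `q'` and `q`, so that each `κ_X` is a
map over `X`. -/
def IsFamilyMap (κ : G' ⟶ G) (q' : ∀ X : Over A, G'.obj X ⟶ X.left)
    (q : ∀ X : Over A, G.obj X ⟶ X.left) : Prop :=
  ∀ X, κ.app X ≫ q X = q' X

theorem IsFamilyMap.weakEquivalence_app {κ : G' ⟶ G} (hκ : IsFamilyMap κ q' q)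
    (hq : IsCartesianFamily q) (hq' : IsCartesianFamily q')
    (hW : MorphismProperty.isomorphisms C ≤ W)
    (hpb : PullbacksLogicallyBehaved F W) (hqT : F (q T)) (hqT' : F (q' T))
    (hκT : W (κ.app T)) {X : Over A} (a : X ⟶ T) : W (κ.app X) := by
  let κ' : Over.mk (q' T) ⟶ Over.mk (q T) := Over.homMk (κ.app T) (hκ T)
  have hfst : ((Over.pullback a.left).map κ').left ≫ pullback.fst (q T) a.left =
      pullback.fst (q' T) a.left ≫ κ.app T := pullback.lift_fst _ _ _
  have hsnd : ((Over.pullback a.left).map κ').left ≫ pullback.snd (q T) a.left =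
      pullback.snd (q' T) a.left := pullback.lift_snd _ _ _
  have e : κ.app X = (hq' a).isoPullback.hom ≫ ((Over.pullback a.left).map κ').left ≫
      (hq a).isoPullback.inv := by
    refine (hq a).hom_ext ?_ ?_
    · simp only [Category.assoc, IsPullback.isoPullback_inv_fst]
      rw [hfst, IsPullback.isoPullback_hom_fst_assoc, κ.naturality]
    · simp only [Category.assoc, IsPullback.isoPullback_inv_snd, hκ X]
      rw [hsnd, IsPullback.isoPullback_hom_snd]
  have hκ' := hpb.between_fibrations a.left _ _ κ' hqT' hqT hκT
  rw [e]
  exact W.comp_mem _ _ (hW _ inferInstance)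
    (W.comp_mem _ _ hκ' (hW _ inferInstance))

theorem IsFamilyMap.transpose_pulledBackEv {κ : G' ⟶ G} (hκ : IsFamilyMap κ q' q)
    (hq : IsCartesianFamily q) (hq' : IsCartesianFamily q')
    (comm : q' T ≫ 𝟙 T.left = κ.app T ≫ q T) {K' : Over (G.obj T)} {top : K'.left ⟶ K}
    {r : P ⟶ T} {e : Over.mk (pullback.snd r.left (𝟙 T.left) ≫ T.hom) ⟶ P}
    (he : e.left = pullback.fst r.left (𝟙 T.left))
    (ev : (Over.pullback (q T)).obj (Over.mk r.left) ⟶ K') :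
    hq'.transpose (pullback.fst K'.hom (κ.app T) ≫ top)
        (Over.homMk (pullback.snd r.left (𝟙 T.left))) (pulledBackEv comm ev) =
      G'.map e ≫ κ.app P ≫ hq.transpose top r ev := by
  let a : Over.mk (pullback.snd r.left (𝟙 T.left) ≫ T.hom) ⟶ T :=
    Over.homMk (pullback.snd r.left (𝟙 T.left))
  have her : e ≫ r = a := Over.OverMorphism.ext (by simp [a, he, pullback.condition])
  have hcond : (pullback.fst a.left (q' T) ≫ e.left) ≫ r.left =
      (pullback.snd a.left (q' T) ≫ κ.app T) ≫ q T := by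
    rw [Category.assoc, Category.assoc, hκ T, ← pullback.condition, ← her]
    rfl
  let l : ((Over.pullback (q' T)).obj (Over.mk a.left)).left ⟶
      ((Over.pullback (q T)).obj (Over.mk r.left)).left :=
    pullback.lift (pullback.fst _ _ ≫ pullback.fst _ _) (pullback.snd _ _ ≫ κ.app T) (he ▸ hcond)
  have hl : (hq'.fibreIso a).hom ≫ l = G'.map e ≫ κ.app P ≫ (hq.fibreIso r).hom := by
    apply over_pullback_hom_ext
    · have hfst : l ≫ pullback.fst r.left (q T) = pullback.fst a.left (q' T) ≫ e.left :=
        (pullback.lift_fst _ _ _).trans (by rw [he]; rfl)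
      simp only [Category.assoc, hfst, IsCartesianFamily.fibreIso_hom_comp_fst, hκ P, (hq' e).w,
        reassoc_of% hq'.fibreIso_hom_comp_fst a]
    · have hsnd : l ≫ ((Over.pullback (q T)).obj (Over.mk r.left)).hom =
          ((Over.pullback (q' T)).obj (Over.mk a.left)).hom ≫ κ.app T := pullback.lift_snd _ _ _
      simp only [Category.assoc, hsnd, IsCartesianFamily.fibreIso_hom_comp_hom, ← her,
        G'.map_comp, κ.naturality, reassoc_of% hq'.fibreIso_hom_comp_hom a]
  have hev : (pulledBackEv comm ev).left ≫ pullback.fst K'.hom (κ.app T) = l ≫ ev.left :=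
    pullback.lift_fst _ _ _
  refine (congr_arg ((hq'.fibreIso a).hom ≫ ·) ((Category.assoc _ _ _).symm.trans
    (congr_arg (· ≫ top) hev))).trans ?_
  simp only [IsCartesianFamily.transpose, Category.assoc, reassoc_of% hl]

theorem IsUniversalLift.weakEquivalence_of_base [F.IsStableUnderBaseChange] {κ : G' ⟶ G}
    (hκ : IsFamilyMap κ q' q) (hq : IsCartesianFamily q) (hq' : IsCartesianFamily q')
    (hW : MorphismProperty.isomorphisms C ≤ W)
    (hpf : PushforwardsLogicallyBehaved F W) (hqT : F (q T)) (hqT' : F (q' T))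
    (hκT : W (κ.app T)) {n : G.obj T ⟶ N} {n' : G'.obj T ⟶ N} {m : K ⟶ N} {r : P ⟶ T}
    {r' : P' ⟶ T} {ε : G.obj P ⟶ K} {ε' : G'.obj P' ⟶ K}
    (h : IsUniversalLift G n m r ε) (h' : IsUniversalLift G' n' m r' ε') (hm : F m)
    (hn : κ.app T ≫ n = n') {t : P ⟶ P'} (ht : t ≫ r' = r) (htε : G'.map t ≫ ε' = κ.app P ≫ ε) :
    W t.left := by
  subst hn
  have sq := IsPullback.of_hasPullback m n
  have sq' := (IsPullback.of_hasPullback (pullback.snd m n) (κ.app T)).paste_horiz sq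
  obtain ⟨ev, hev, rfl⟩ := h.exists_transpose_eq hq
    (K' := (Over.pullback n).obj (Over.mk m)) sq
  obtain ⟨ev', hev', rfl⟩ := h'.exists_transpose_eq hq'
    (K' := (Over.pullback (κ.app T)).obj ((Over.pullback n).obj (Over.mk m))) sq'
  have comm : q' T ≫ 𝟙 T.left = κ.app T ≫ q T := (Category.comp_id _).trans (hκ T).symm
  let X : Over A := Over.mk (pullback.snd r.left (𝟙 T.left) ≫ T.hom)
  let a : X ⟶ T := Over.homMk (pullback.snd r.left (𝟙 T.left))
  have hfst : pullback.fst r.left (𝟙 T.left) ≫ r.left = a.left := by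
    simp [a, pullback.condition]
  let e : X ⟶ P := Over.homMk (pullback.fst r.left (𝟙 T.left))
    (by rw [← Over.w r, reassoc_of% hfst, Over.w])
  have her : e ≫ r = a := Over.OverMorphism.ext hfst
  let t' : (Over.pullback (𝟙 T.left)).obj (Over.mk r.left) ⟶ Over.mk r'.left :=
    Over.homMk (e ≫ t).left
      (congr_arg (·.left) (show (e ≫ t) ≫ r' = a by rw [Category.assoc, ht, her]))
  have ht' : W t'.left := by
    refine hpf.precomposition (q T) (q' T) (𝟙 _) (κ.app T) comm _ _ _ ev ev' t' hqT hqT'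
      (hW _ (inferInstanceAs (IsIso (𝟙 _)))) hκT (F.pullback_snd m n hm) hev hev' ?_
    refine hq'.transpose_injective sq' a
      ((hq'.transpose_map_comp (a := a) (r := r') (e ≫ t) t' rfl ev').trans ?_)
    rw [G'.map_comp, Category.assoc, htε]
    exact (hκ.transpose_pulledBackEv hq hq' comm (e := e) rfl ev).symm
  exact W.of_precomp _ _ (hW _ (inferInstanceAs (IsIso (pullback.fst r.left (𝟙 T.left))))) ht'

end WeakEquivalences

/-! ### Partial lifts -/

section PartialLifts

variable {I : Type u₁} [Category.{v₁} I] {C : Type u₂} [Category.{v₂} C] {B K : I ⥤ C}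
  {k : K ⟶ B} {i : I} {S S' : Set (Under i)}

/-- Diagrams on `i/I` over the restriction of `B`. -/
abbrev UnderDiagram (B : I ⥤ C) (i : I) := Over (Under.forget i ⋙ B)

/-- The component `Y_f ⟶ B_j` at `f : i ⟶ j` of the structure map of `Y`. -/
def UnderDiagram.proj (Y : UnderDiagram B i) (f : Under i) : Y.left.obj f ⟶ B.obj f.right :=
  Y.hom.app f

/-- The functor `Y ↦ Y_f`. -/
abbrev UnderDiagram.eval (B : I ⥤ C) {i : I} (f : Under i) : UnderDiagram B i ⥤ C :=
  Over.forget _ ⋙ (evaluation _ _).obj f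

theorem UnderDiagram.map_comp_proj (Y : UnderDiagram B i) {f g : Under i} (a : f ⟶ g) :
    Y.left.map a ≫ Y.proj g = Y.proj f ≫ B.map a.right :=
  Y.hom.naturality a

theorem UnderDiagram.app_comp_proj {Y Y' : UnderDiagram B i} (t : Y' ⟶ Y) (f : Under i) :
    t.left.app f ≫ Y.proj f = Y'.proj f :=
  congr_app (Over.w t) f

/-- A *partial lift* of `Y` through `k` is a lift of the structure map of `Y` through `k` defined on
the maps out of `i` that belong to `S`. -/
@[ext]
structure PartialLift (k : K ⟶ B) (S : Set (Under i)) (Y : UnderDiagram B i) where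
  fam : ∀ f ∈ S, Y.left.obj f ⟶ K.obj f.right
  fam_comp : ∀ f hf, fam f hf ≫ k.app f.right = Y.proj f
  fam_map : ∀ ⦃f g : Under i⦄ (a : f ⟶ g) (hf : f ∈ S) (hg : g ∈ S),
    fam f hf ≫ K.map a.right = Y.left.map a ≫ fam g hg

namespace PartialLift

variable {Y Y' Y'' : UnderDiagram B i}

/-- The restriction of a partial lift of `Y` along `Y' ⟶ Y`. -/
@[simps]
def pull (σ : PartialLift k S Y) (t : Y' ⟶ Y) : PartialLift k S Y' where
  fam f hf := t.left.app f ≫ σ.fam f hf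
  fam_comp f hf := by rw [Category.assoc, σ.fam_comp, UnderDiagram.app_comp_proj]
  fam_map f g a hf hg := by rw [Category.assoc, σ.fam_map a hf hg, t.left.naturality_assoc]

/-- The restriction of a partial lift to a smaller set of maps. -/
@[simps]
def restrict (σ : PartialLift k S Y) (h : S' ⊆ S) : PartialLift k S' Y where
  fam f hf := σ.fam f (h hf)
  fam_comp f hf := σ.fam_comp f (h hf)
  fam_map _ _ a hf hg := σ.fam_map a (h hf) (h hg)

theorem pull_id (σ : PartialLift k S Y) : σ.pull (𝟙 Y) = σ := by
  ext f hf
  exact Category.id_comp _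

theorem pull_comp (σ : PartialLift k S Y) (t : Y' ⟶ Y) (t' : Y'' ⟶ Y') :
    σ.pull (t' ≫ t) = (σ.pull t).pull t' := by
  ext f hf
  exact Category.assoc _ _ _

theorem restrict_pull (σ : PartialLift k S Y) (t : Y' ⟶ Y) (h : S' ⊆ S) :
    (σ.pull t).restrict h = (σ.restrict h).pull t := rfl

/-- A partial lift of `Φ T` is *universal* if it represents the partial lifts of the diagrams
`Φ X`. -/
def IsUniversal {𝒜 : Type*} [Category 𝒜] (Φ : 𝒜 ⥤ UnderDiagram B i) {T : 𝒜}
    (σ : PartialLift k S (Φ.obj T)) : Prop :=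
  ∀ (X : 𝒜) (τ : PartialLift k S (Φ.obj X)), ∃! t : X ⟶ T, σ.pull (Φ.map t) = τ

namespace IsUniversal

variable {𝒜 : Type*} [Category 𝒜] {Φ : 𝒜 ⥤ UnderDiagram B i} {T T' : 𝒜}
  {σ : PartialLift k S (Φ.obj T)} {σ' : PartialLift k S (Φ.obj T')}

theorem hom_ext (h : σ.IsUniversal Φ) {X : 𝒜} {t t' : X ⟶ T}
    (ht : σ.pull (Φ.map t) = σ.pull (Φ.map t')) : t = t' :=
  (h X _).unique ht rfl

theorem isIso (h : σ.IsUniversal Φ) (h' : σ'.IsUniversal Φ) {t : T' ⟶ T}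
    (ht : σ.pull (Φ.map t) = σ') : IsIso t := by
  obtain ⟨s, hs, -⟩ := h' T σ
  refine ⟨s, h'.hom_ext ?_, h.hom_ext ?_⟩
  · rw [Φ.map_comp, pull_comp, hs, ht, Φ.map_id, pull_id]
  · rw [Φ.map_comp, pull_comp, ht, hs, Φ.map_id, pull_id]

theorem pull_isIso (h : σ.IsUniversal Φ) (t : T' ⟶ T) [IsIso t] :
    (σ.pull (Φ.map t)).IsUniversal Φ := by
  intro X τ
  obtain ⟨s, hs, hs'⟩ := h X τ
  refine ⟨s ≫ inv t, ?_, fun r hr => ?_⟩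
  · dsimp only
    rw [← pull_comp, ← Φ.map_comp, Category.assoc, IsIso.inv_hom_id, Category.comp_id, hs]
  · dsimp only at hr
    rw [← pull_comp, ← Φ.map_comp] at hr
    rw [← hs' _ hr, Category.assoc, IsIso.hom_inv_id, Category.comp_id]

theorem restrict_iff (h : S' = S) : (σ.restrict h.subset).IsUniversal Φ ↔ σ.IsUniversal Φ := by
  subst h
  rfl

end IsUniversal

end PartialLift

end PartialLifts

section CosieveSteps

variable {I : Type u₁} [Category.{v₁} I] {C : Type u₂} [Category.{v₂} C] {B K : I ⥤ C}
  {k : K ⟶ B} {i : I} {S : Set (Under i)} {f : Under i}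

/-- A *cosieve* of maps out of `i` is a set of maps closed under postcomposition. -/
def IsCosieve (S : Set (Under i)) : Prop :=
  ∀ ⦃g h : Under i⦄, g ∈ S → (g ⟶ h) → h ∈ S

/-- Adding `f` to the cosieve `S` gives another cosieve, and the only new map is `f`. -/
structure IsCosieveStep (S : Set (Under i)) (f : Under i) : Prop where
  closed : IsCosieve S
  notMem : f ∉ S
  boundary_mem : ∀ b : Boundary f.right, Under.mk (f.hom ≫ b.obj.hom) ∈ S

theorem eq_id_of_identities {f : i ⟶ i} (h : MorphismProperty.identities I f) : f = 𝟙 i := by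
  cases h
  rfl

theorem under_hom_induction {f : Under i} {motive : ∀ ⦃g : Under i⦄, (f ⟶ g) → Prop}
    (comp : ∀ ⦃j : I⦄ (b : f.right ⟶ j), motive (g := Under.mk (f.hom ≫ b)) (Under.homMk b))
    {g : Under i} (a : f ⟶ g) : motive a := by
  suffices ∀ ⦃j : I⦄ (b : f.right ⟶ j) (x : i ⟶ j) (h : f.hom ≫ b = x),
      motive (g := Under.mk x) (Under.homMk b h) from this a.right g.hom (Under.w a)
  rintro j b _ rfl
  exact comp b

theorem IsCosieveStep.endo_eq_id (hf : IsCosieveStep S f) (a : f ⟶ f) : a = 𝟙 f := by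
  refine Under.UnderMorphism.ext (eq_id_of_identities ?_)
  by_contra ha
  have h : Under.mk (f.hom ≫ a.right) ∈ S := hf.boundary_mem (Boundary.mk a.right ha)
  rw [Under.w] at h
  exact hf.notMem h

section Matching

variable [HasFiniteLimits C] [∀ i : I, Finite (Under i)] {X X' : I ⥤ C} {Z : C}

theorem matchingObj_hom_ext {x y : Z ⟶ matchingObj X i}
    (h : ∀ b, x ≫ matchingProj X i b = y ≫ matchingProj X i b) : x = y :=
  limit.hom_ext h

/-- The map into the matching object given by a compatible family. -/
noncomputable def matchingLift (x : ∀ b : Boundary i, Z ⟶ X.obj b.obj.right)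
    (w : ∀ ⦃b b' : Boundary i⦄ (a : b ⟶ b'), x b ≫ X.map a.hom.right = x b') :
    Z ⟶ matchingObj X i :=
  limit.lift (boundaryDiagram X i)
    { pt := Z
      π := { app := x, naturality := fun _ _ a => (Category.id_comp _).trans (w a).symm } }

theorem matchingLift_proj (x : ∀ b : Boundary i, Z ⟶ X.obj b.obj.right)
    (w : ∀ ⦃b b' : Boundary i⦄ (a : b ⟶ b'), x b ≫ X.map a.hom.right = x b') (b : Boundary i) :
    matchingLift x w ≫ matchingProj X i b = x b :=
  limit.lift_π _ b

theorem matchingProj_map (X : I ⥤ C) (i : I) {b b' : Boundary i} (a : b ⟶ b') :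
    matchingProj X i b ≫ X.map a.hom.right = matchingProj X i b' :=
  limit.w (boundaryDiagram X i) a

theorem relativeMatchingMap_fst (q : X ⟶ X') (i : I) :
    relativeMatchingMap q i ≫ pullback.fst _ _ = q.app i :=
  pullback.lift_fst _ _ _

theorem relativeMatchingMap_snd (q : X ⟶ X') (i : I) :
    relativeMatchingMap q i ≫ pullback.snd _ _ = matchingMap X i :=
  pullback.lift_snd _ _ _

end Matching

namespace PartialLift

variable {Y Y' : UnderDiagram B i}

/-- The map `f ⟶ f ≫ b` of `i/I`. -/
abbrev underToComp (f : Under i) (b : Boundary f.right) : f ⟶ Under.mk (f.hom ≫ b.obj.hom) :=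
  Under.homMk b.obj.hom

/-- The value at `f ≫ b` of a partial lift defined on the maps beyond `f`, as a map out of `Y_f`. -/
def continuation (hf : IsCosieveStep S f) (σ : PartialLift k S Y) (b : Boundary f.right) :
    Y.left.obj f ⟶ K.obj b.obj.right :=
  Y.left.map (underToComp f b) ≫ σ.fam _ (hf.boundary_mem b)

theorem continuation_map (hf : IsCosieveStep S f) (σ : PartialLift k S Y)
    ⦃b b' : Boundary f.right⦄ (a : b ⟶ b') :
    σ.continuation hf b ≫ K.map a.hom.right = σ.continuation hf b' := by
  let a' : Under.mk (f.hom ≫ b.obj.hom) ⟶ Under.mk (f.hom ≫ b'.obj.hom) :=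
    Under.homMk a.hom.right (by simp)
  have ha : underToComp f b ≫ a' = underToComp f b' := Under.UnderMorphism.ext (Under.w a.hom)
  have h := σ.fam_map a' (hf.boundary_mem b) (hf.boundary_mem b')
  rw [continuation, continuation, Category.assoc, ← ha, Y.left.map_comp, Category.assoc, ← h]
  rfl

theorem continuation_comp (hf : IsCosieveStep S f) (σ : PartialLift k S Y) (b : Boundary f.right) :
    σ.continuation hf b ≫ k.app b.obj.right = Y.proj f ≫ B.map b.obj.hom := by
  have h := σ.fam_comp _ (hf.boundary_mem b)
  rw [continuation, Category.assoc]
  exact (congr_arg (_ ≫ ·) h).trans (Y.map_comp_proj (underToComp f b))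

theorem continuation_pull (hf : IsCosieveStep S f) (σ : PartialLift k S Y) (t : Y' ⟶ Y)
    (b : Boundary f.right) :
    (σ.pull t).continuation hf b = t.left.app f ≫ σ.continuation hf b := by
  simp only [continuation, pull_fam, t.left.naturality_assoc]

theorem ext_insert {σ τ : PartialLift k (insert f S) Y}
    (h : σ.restrict (Set.subset_insert f S) = τ.restrict (Set.subset_insert f S))
    (hf : σ.fam f (Set.mem_insert f S) = τ.fam f (Set.mem_insert f S)) : σ = τ := by
  ext g hg
  obtain rfl | hg' := hg
  · exact hf
  · exact congr_fun (congr_fun (congr_arg fam h) g) hg'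

theorem exists_extension (hf : IsCosieveStep S f) (σ : PartialLift k S Y)
    {u : Y.left.obj f ⟶ K.obj f.right} (hu : u ≫ k.app f.right = Y.proj f)
    (hub : ∀ b, u ≫ K.map b.obj.hom = σ.continuation hf b) :
    ∃ τ : PartialLift k (insert f S) Y,
      τ.restrict (Set.subset_insert f S) = σ ∧ τ.fam f (Set.mem_insert f S) = u := by
  classical
  let fam (g : Under i) (hg : g ∈ insert f S) : Y.left.obj g ⟶ K.obj g.right :=
    if e : g = f then Y.left.map (eqToHom e) ≫ u ≫ K.map (eqToHom e.symm).right
    else σ.fam g (hg.resolve_left e)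
  have fam_self (hg) : fam f hg = u := by simp [fam]
  have fam_of_mem {g} (hg : g ∈ S) (hg') : fam g hg' = σ.fam g hg :=
    dif_neg fun e : g = f => hf.notMem (e ▸ hg)
  refine ⟨⟨fam, ?_, ?_⟩, ?_, fam_self (Set.mem_insert f S)⟩
  · rintro g (rfl | hg)
    · rw [fam_self (Set.mem_insert _ _), hu]
    · rw [fam_of_mem hg (Set.mem_insert_of_mem _ hg), σ.fam_comp]
  · rintro g g' a (rfl | hg) (rfl | hg')
    · obtain rfl := hf.endo_eq_id a
      simp
    · have h : u ≫ K.map a.right = Y.left.map a ≫ σ.fam g' hg' := by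
        induction a using under_hom_induction with | comp b =>
        have hb : ¬ MorphismProperty.identities I b := by
          rintro ⟨⟩
          rw [Category.comp_id] at hg'
          exact hf.notMem hg'
        exact hub (Boundary.mk b hb)
      rw [fam_self (Set.mem_insert _ _), fam_of_mem hg' (Set.mem_insert_of_mem _ hg'), h]
    · exact absurd (hf.closed hg a) hf.notMem
    · rw [fam_of_mem hg (Set.mem_insert_of_mem _ hg),
        fam_of_mem hg' (Set.mem_insert_of_mem _ hg'), σ.fam_map a hg hg']
  · ext g hg
    exact fam_of_mem hg (Set.mem_insert_of_mem f hg)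

section StepMap

variable [HasFiniteLimits C] [∀ i : I, Finite (Under i)]

/-- The map `Y_f ⟶ B_j ×_{M_j B} M_j K` at `f : i ⟶ j` given by a partial lift defined on the maps
beyond `f`. Its lifts through the relative matching map of `k` are the extensions of the partial
lift to `f`. -/
noncomputable def stepMap (hf : IsCosieveStep S f) (σ : PartialLift k S Y) :
    Y.left.obj f ⟶ pullback (matchingMap B f.right) (matchingObjMap k f.right) :=
  pullback.lift (Y.proj f) (matchingLift (σ.continuation hf) (σ.continuation_map hf)) <|
    matchingObj_hom_ext fun b => by
      simp only [Category.assoc, matchingMap_proj, matchingObjMap_proj,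
        reassoc_of% matchingLift_proj _ (σ.continuation_map hf), continuation_comp]

theorem comp_relativeMatchingMap_eq_stepMap_iff (hf : IsCosieveStep S f) (σ : PartialLift k S Y)
    (u : Y.left.obj f ⟶ K.obj f.right) :
    u ≫ relativeMatchingMap k f.right = σ.stepMap hf ↔
      u ≫ k.app f.right = Y.proj f ∧ ∀ b, u ≫ K.map b.obj.hom = σ.continuation hf b := by
  have hsnd : (u ≫ relativeMatchingMap k f.right) ≫ pullback.snd _ _ =
      σ.stepMap hf ≫ pullback.snd _ _ ↔ ∀ b, u ≫ K.map b.obj.hom = σ.continuation hf b := by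
    rw [Category.assoc, relativeMatchingMap_snd, stepMap, pullback.lift_snd]
    refine ⟨fun h b => ?_, fun h => matchingObj_hom_ext fun b => ?_⟩
    · rw [← matchingMap_proj, reassoc_of% h, matchingLift_proj]
    · rw [Category.assoc, matchingMap_proj, h, matchingLift_proj]
  have hfst : (u ≫ relativeMatchingMap k f.right) ≫ pullback.fst _ _ =
      σ.stepMap hf ≫ pullback.fst _ _ ↔ u ≫ k.app f.right = Y.proj f := by
    rw [Category.assoc, relativeMatchingMap_fst, stepMap, pullback.lift_fst]
  rw [← hfst, ← hsnd]
  exact ⟨fun h => ⟨by rw [h], by rw [h]⟩, fun h => pullback.hom_ext h.1 h.2⟩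

theorem stepMap_pull (hf : IsCosieveStep S f) (σ : PartialLift k S Y) (t : Y' ⟶ Y) :
    (σ.pull t).stepMap hf = t.left.app f ≫ σ.stepMap hf := by
  apply pullback.hom_ext
  · simp only [stepMap, Category.assoc, pullback.lift_fst, UnderDiagram.app_comp_proj]
  · simp only [stepMap, Category.assoc, pullback.lift_snd]
    refine matchingObj_hom_ext fun b => ?_
    rw [Category.assoc, matchingLift_proj, matchingLift_proj, continuation_pull]

theorem fam_comp_relativeMatchingMap (hf : IsCosieveStep S f) (τ : PartialLift k (insert f S) Y) :
    τ.fam f (Set.mem_insert f S) ≫ relativeMatchingMap k f.right =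
      (τ.restrict (Set.subset_insert f S)).stepMap hf :=
  (comp_relativeMatchingMap_eq_stepMap_iff hf _ _).2
    ⟨τ.fam_comp f _, fun b => τ.fam_map (underToComp f b) _ _⟩

theorem exists_extension_of_comp_eq (hf : IsCosieveStep S f) (σ : PartialLift k S Y)
    {u : Y.left.obj f ⟶ K.obj f.right} (hu : u ≫ relativeMatchingMap k f.right = σ.stepMap hf) :
    ∃ τ : PartialLift k (insert f S) Y,
      τ.restrict (Set.subset_insert f S) = σ ∧ τ.fam f (Set.mem_insert f S) = u := by
  rw [comp_relativeMatchingMap_eq_stepMap_iff] at hu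
  exact exists_extension hf σ hu.1 hu.2

theorem isUniversal_insert_iff {𝒜 : Type*} [Category 𝒜] {Φ : 𝒜 ⥤ UnderDiagram B i} {T P : 𝒜}
    (hf : IsCosieveStep S f) {σ : PartialLift k S (Φ.obj T)} (hσ : σ.IsUniversal Φ)
    {τ : PartialLift k (insert f S) (Φ.obj P)} {r : P ⟶ T}
    (hr : τ.restrict (Set.subset_insert f S) = σ.pull (Φ.map r)) :
    τ.IsUniversal Φ ↔ IsUniversalLift (Φ ⋙ UnderDiagram.eval B f) (σ.stepMap hf)
      (relativeMatchingMap k f.right) r (τ.fam f (Set.mem_insert f S)) := by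
  have restrict_pull_eq {X : 𝒜} (t : X ⟶ P) :
      (τ.pull (Φ.map t)).restrict (Set.subset_insert f S) = σ.pull (Φ.map (t ≫ r)) := by
    rw [restrict_pull, hr, Φ.map_comp, pull_comp]
  constructor
  · refine fun hτ => ⟨?_, fun X a u hu => ?_⟩
    · exact (fam_comp_relativeMatchingMap hf τ).trans (by rw [hr, stepMap_pull]; rfl)
    · obtain ⟨ρ, hρ, rfl⟩ := exists_extension_of_comp_eq hf (σ.pull (Φ.map a))
        (hu.trans (stepMap_pull hf σ _).symm)
      obtain ⟨t, rfl, ht⟩ := hτ X ρ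
      refine ⟨t, ⟨hσ.hom_ext ((restrict_pull_eq t).symm.trans hρ), rfl⟩, fun s hs => ht s ?_⟩
      exact ext_insert (by rw [hρ, restrict_pull_eq, hs.1]) hs.2
  · intro h X ρ
    obtain ⟨a, ha, -⟩ := hσ X (ρ.restrict (Set.subset_insert f S))
    obtain ⟨t, ⟨rfl, htf⟩, ht⟩ := h.existsUnique a (ρ.fam f (Set.mem_insert f S))
      ((fam_comp_relativeMatchingMap hf ρ).trans (by rw [← ha, stepMap_pull]; rfl))
    refine ⟨t, ext_insert ((restrict_pull_eq t).trans ha) htf, ?_⟩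
    rintro s rfl
    exact ht s ⟨hσ.hom_ext ((restrict_pull_eq s).symm.trans ha.symm), rfl⟩

end StepMap

end PartialLift

end CosieveSteps

section CosieveInduction

variable {I : Type u₁} [Category.{v₁} I] {i : I}

theorem under_eq_of_identities {f g : Under i} (a : f ⟶ g)
    (ha : MorphismProperty.identities I a.right) : f = g := by
  induction a using under_hom_induction with | comp b =>
  obtain ⟨⟩ := ha
  exact congr_arg Under.mk (Category.comp_id f.hom).symm

theorem insert_id_boundary (i : I) : insert (Under.mk (𝟙 i)) {f | boundaryProp i f} = Set.univ := by
  refine Set.eq_univ_of_forall fun f => or_iff_not_imp_right.2 fun hf => Eq.symm ?_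
  exact under_eq_of_identities (Under.homMk f.hom) (not_not.1 hf)

theorem isCosieve_univ (i : I) : IsCosieve (Set.univ : Set (Under i)) := fun _ _ _ _ => trivial

namespace IsInverseCategory

theorem isCosieveStep_boundary (hI : IsInverseCategory I) (i : I) :
    IsCosieveStep {f : Under i | boundaryProp i f} (Under.mk (𝟙 i)) where
  closed g h hg a hh := by
    obtain ⟨deg, hdeg⟩ := hI
    have hdeg_le : deg h.right ≤ deg g.right := by
      by_cases ha : MorphismProperty.identities I a.right
      · rw [under_eq_of_identities a ha]
      · exact (hdeg a.right ha).le
    rw [← under_eq_of_identities (f := Under.mk (𝟙 i)) (Under.homMk h.hom) hh] at hdeg_le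
    exact (hdeg g.hom hg).not_ge hdeg_le
  notMem h := h ⟨i⟩
  boundary_mem b := by
    have hb : Under.mk (𝟙 i ≫ b.obj.hom) = b.obj := congr_arg Under.mk (Category.id_comp b.obj.hom)
    exact hb.symm ▸ b.property

/-- A map in `S` whose codomain has maximal degree can be removed from `S`. -/
theorem exists_isCosieveStep (hI : IsInverseCategory I) [Finite (Under i)] {S : Set (Under i)}
    (hS : IsCosieve S) (hne : S.Nonempty) : ∃ S' f, IsCosieveStep S' f ∧ insert f S' = S := by
  obtain ⟨deg, hdeg⟩ := hI
  obtain ⟨f, hf, hmax⟩ := Set.exists_max_image S (fun f => deg f.right) S.toFinite hne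
  refine ⟨S \ {f}, f, ⟨fun g h hg a => ⟨hS hg.1 a, ?_⟩, by simp, fun b => ⟨?_, fun hb => ?_⟩⟩,
    Set.insert_sdiff_self_of_mem hf⟩
  · rintro rfl
    by_cases ha : MorphismProperty.identities I a.right
    · exact hg.2 (under_eq_of_identities a ha)
    · exact (hdeg a.right ha).not_ge (hmax g hg.1)
  · exact hS hf (Under.homMk b.obj.hom)
  · have hdeg_eq : deg b.obj.right = deg f.right := congr_arg (fun g : Under i => deg g.right) hb
    exact (hdeg b.obj.hom b.property).ne hdeg_eq

theorem cosieve_induction (hI : IsInverseCategory I) [Finite (Under i)]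
    {motive : Set (Under i) → Prop} (empty : motive ∅)
    (insert : ∀ S f, IsCosieveStep S f → motive S → motive (insert f S)) {S : Set (Under i)}
    (hS : IsCosieve S) : motive S := by
  induction hn : S.ncard using Nat.strong_induction_on generalizing S with
  | _ n ih =>
    subst hn
    obtain rfl | hne := S.eq_empty_or_nonempty
    · exact empty
    · obtain ⟨S', f, hf, rfl⟩ := hI.exists_isCosieveStep hS hne
      exact insert S' f hf <|
        ih _ (Set.ncard_lt_ncard (Set.ssubset_insert hf.notMem) (Set.toFinite _)) hf.closed rfl

end IsInverseCategory

end CosieveInduction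

/-! ### Existence of universal partial lifts -/

section Existence

variable {I : Type u₁} [Category.{v₁} I] {C : Type u₂} [Category.{v₂} C] {B K : I ⥤ C}
  {k : K ⟶ B} {i : I}

namespace PartialLift

/-- The unique partial lift defined on no map at all. -/
def empty (k : K ⟶ B) (Y : UnderDiagram B i) : PartialLift k ∅ Y where
  fam _ hf := hf.elim
  fam_comp _ hf := hf.elim
  fam_map _ _ _ hf := hf.elim

theorem isUniversal_empty {𝒜 : Type*} [Category 𝒜] (k : K ⟶ B) (Φ : 𝒜 ⥤ UnderDiagram B i) {T : 𝒜}
    (hT : IsTerminal T) : (empty k (Φ.obj T)).IsUniversal Φ := fun X τ =>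
  ⟨hT.from X, by ext f hf; exact hf.elim, fun _ _ => hT.hom_ext _ _⟩

theorem exists_isUniversal [HasFiniteLimits C] [∀ i : I, Finite (Under i)]
    (hI : IsInverseCategory I) {F : MorphismProperty C} [F.IsMultiplicative] {A₀ : C}
    {Φ : Over A₀ ⥤ UnderDiagram B i} (hk : IsReedyFibration F k)
    (hΦ : ∀ f, LiftsFibrations F (Φ ⋙ UnderDiagram.eval B f)) {S : Set (Under i)}
    (hS : IsCosieve S) :
    ∃ (T : Over A₀) (σ : PartialLift k S (Φ.obj T)), σ.IsUniversal Φ ∧ F T.hom := by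
  refine hI.cosieve_induction (motive := fun S => ∃ (T : Over A₀) (σ : PartialLift k S (Φ.obj T)),
    σ.IsUniversal Φ ∧ F T.hom) ?_ ?_ hS
  · exact ⟨_, _, isUniversal_empty k Φ Over.mkIdTerminal, F.id_mem A₀⟩
  · rintro S f hf ⟨T, σ, hσ, hT⟩
    obtain ⟨P, r, ε, h, hr⟩ := hΦ f (σ.stepMap hf) _ (hk f.right)
    obtain ⟨τ, hτ, rfl⟩ := exists_extension_of_comp_eq hf (σ.pull (Φ.map r))
      (h.fac.trans (stepMap_pull hf σ _).symm)
    refine ⟨P, τ, (isUniversal_insert_iff hf hσ hτ).2 h, ?_⟩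
    rw [← Over.w r]
    exact F.comp_mem _ _ hr hT

end PartialLift

/-- The constant diagram on `i/I` at an object over `B_i`. -/
def UnderDiagram.const (B : I ⥤ C) (i : I) : Over (B.obj i) ⥤ UnderDiagram B i where
  obj Y := Over.mk (Y := (Functor.const _).obj Y.left)
    { app f := Y.hom ≫ B.map f.hom
      naturality f g a := by simp [← B.map_comp] }
  map t := Over.homMk ((Functor.const _).map t.left)

namespace PartialLift

/-- The partial lift, defined on all maps out of `i`, of a constant diagram given by a map to
`K_i`. -/
def const {Y : Over (B.obj i)} (u : Y ⟶ Over.mk (k.app i)) :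
    PartialLift k Set.univ ((UnderDiagram.const B i).obj Y) where
  fam f _ := u.left ≫ K.map f.hom
  fam_comp f _ := (Category.assoc _ _ _).trans <|
    (congr_arg (u.left ≫ ·) (k.naturality f.hom)).trans (Over.w_assoc u _)
  fam_map f g a _ _ := by
    have ha : K.map f.hom ≫ K.map a.right = K.map g.hom := by rw [← K.map_comp, Under.w]
    exact (Category.assoc _ _ _).trans <|
      (congr_arg (u.left ≫ ·) ha).trans (Category.id_comp (u.left ≫ K.map g.hom)).symm

theorem const_comp {Y Y' : Over (B.obj i)} (t : Y' ⟶ Y) (u : Y ⟶ Over.mk (k.app i)) :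
    const (t ≫ u) = (const u).pull ((UnderDiagram.const B i).map t) := by
  ext f _
  exact Category.assoc _ _ _

theorem const_bijective (Y : Over (B.obj i)) :
    Function.Bijective (const : (Y ⟶ Over.mk (k.app i)) → _) := by
  have const_fam (u : Y ⟶ Over.mk (k.app i)) : (const u).fam (Under.mk (𝟙 i)) trivial = u.left :=
    (congr_arg (u.left ≫ ·) (K.map_id i)).trans (Category.comp_id _)
  refine ⟨fun u u' h => Over.OverMorphism.ext ?_, fun σ => ?_⟩
  · rw [← const_fam, h, const_fam]
  · refine ⟨Over.homMk (σ.fam (Under.mk (𝟙 i)) trivial) ?_, ?_⟩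
    · exact (σ.fam_comp _ _).trans ((congr_arg (Y.hom ≫ ·) (B.map_id i)).trans (Category.comp_id _))
    · ext f hf
      exact (σ.fam_map (Under.homMk f.hom : Under.mk (𝟙 i) ⟶ f) trivial hf).trans
        (Category.id_comp (σ.fam f hf))

theorem isUniversal_const_iff {𝒜 : Type*} [Category 𝒜] {H : 𝒜 ⥤ Over (B.obj i)} {R : 𝒜}
    (u : H.obj R ⟶ Over.mk (k.app i)) :
    (const u).IsUniversal (H ⋙ UnderDiagram.const B i) ↔
      ∀ (X : 𝒜) (v : H.obj X ⟶ Over.mk (k.app i)), ∃! t : X ⟶ R, H.map t ≫ u = v := by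
  refine forall_congr' fun X => (const_bijective (H.obj X)).surjective.forall.trans <|
    forall_congr' fun v => existsUnique_congr fun t => ?_
  rw [Functor.comp_map, ← const_comp, (const_bijective (H.obj X)).injective.eq_iff]

end PartialLift

theorem liftsFibrations_forget [HasPullbacks C] {F : MorphismProperty C}
    [F.IsStableUnderBaseChange] (A₀ : C) : LiftsFibrations F (Over.forget A₀) := by
  intro T N K n m hm
  refine ⟨Over.mk (pullback.snd m n ≫ T.hom), Over.homMk (pullback.snd m n), pullback.fst m n,
    ⟨pullback.condition, fun X a u hu => ?_⟩, F.pullback_snd m n hm⟩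
  let l : X.left ⟶ pullback m n := pullback.lift u a.left hu
  have hl₁ : l ≫ pullback.fst m n = u := pullback.lift_fst _ _ _
  have hl₂ : l ≫ pullback.snd m n = a.left := pullback.lift_snd _ _ _
  have hl : l ≫ pullback.snd m n ≫ T.hom = X.hom :=
    (Category.assoc _ _ _).symm.trans ((congr_arg (· ≫ T.hom) hl₂).trans (Over.w a))
  refine ⟨Over.homMk l hl, ⟨Over.OverMorphism.ext hl₂, hl₁⟩, fun s hs => ?_⟩
  refine Over.OverMorphism.ext (pullback.hom_ext (hs.2.trans hl₁.symm) ?_)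
  exact (congr_arg (·.left) hs.1).trans hl₂.symm

theorem IsReedyFibration.app [HasFiniteLimits C] [∀ i : I, Finite (Under i)]
    (hI : IsInverseCategory I) {F : MorphismProperty C} [F.IsMultiplicative]
    [F.IsStableUnderBaseChange] (hk : IsReedyFibration F k) (i : I) : F (k.app i) := by
  obtain ⟨T, τ, hτ, hT⟩ := PartialLift.exists_isUniversal (Φ := 𝟭 _ ⋙ UnderDiagram.const B i) hI hk
    (fun _ => liftsFibrations_forget _) (isCosieve_univ i)
  have hσ := (PartialLift.isUniversal_const_iff (H := 𝟭 _) (𝟙 (Over.mk (k.app i)))).2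
    fun _ v => ⟨v, Category.comp_id v, fun t ht => (Category.comp_id t).symm.trans ht⟩
  obtain ⟨t, ht, -⟩ := hτ _ (PartialLift.const (𝟙 (Over.mk (k.app i))))
  have : IsIso t := hτ.isIso hσ ht
  have hti : IsIso t.left := inferInstanceAs (IsIso ((Over.forget _).map t))
  rw [show k.app i = t.left ≫ T.hom from (Over.w t).symm]
  exact (F.cancel_left_of_respectsIso t.left T.hom).2 hT

namespace PartialLift

variable {S : Set (Under i)}

/-- The value at `f` of a partial lift of a constant diagram. -/
def value {X : Over (B.obj i)} (ζ : PartialLift k S ((UnderDiagram.const B i).obj X)) (f : Under i)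
    (hf : f ∈ S) : X.left ⟶ K.obj f.right :=
  ζ.fam f hf

/-- The partial lift of a constant diagram with given values. -/
def ofValues {X : Over (B.obj i)} (z : ∀ f ∈ S, X.left ⟶ K.obj f.right)
    (hz : ∀ f hf, z f hf ≫ k.app f.right = X.hom ≫ B.map f.hom)
    (hz' : ∀ ⦃f g : Under i⦄ (a : f ⟶ g) hf hg, z f hf ≫ K.map a.right = z g hg) :
    PartialLift k S ((UnderDiagram.const B i).obj X) where
  fam := z
  fam_comp := hz
  fam_map _ g a hf hg := (hz' a hf hg).trans (Category.id_comp (z g hg)).symm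

section Value

variable {X X' : Over (B.obj i)} (ζ : PartialLift k S ((UnderDiagram.const B i).obj X))

theorem value_comp (f : Under i) (hf : f ∈ S) :
    ζ.value f hf ≫ k.app f.right = X.hom ≫ B.map f.hom :=
  ζ.fam_comp f hf

theorem value_map {f g : Under i} (a : f ⟶ g) (hf : f ∈ S) (hg : g ∈ S) :
    ζ.value f hf ≫ K.map a.right = ζ.value g hg :=
  (ζ.fam_map a hf hg).trans (Category.id_comp _)

variable {ζ} in
theorem ext_value {ζ' : PartialLift k S ((UnderDiagram.const B i).obj X)}
    (h : ∀ f hf, ζ.value f hf = ζ'.value f hf) : ζ = ζ' :=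
  PartialLift.ext (funext₂ h)

theorem value_pull (t : X' ⟶ X) (f : Under i) (hf : f ∈ S) :
    (ζ.pull ((UnderDiagram.const B i).map t)).value f hf = t.left ≫ ζ.value f hf := rfl

end Value

end PartialLift

end Existence

section BaseChange

variable {I : Type u₁} [Category.{v₁} I] {C : Type u₂} [Category.{v₂} C] [HasPullbacks C]
  {A B K : I ⥤ C} {p : B ⟶ A} {k : K ⟶ B} {i j l : I} {S : Set (Under i)}

/-- The diagram `f ↦ X ×_{A_j} B_j` on `i/I` associated with an object `X` over `A_i`. -/
noncomputable def UnderDiagram.baseChange (p : B ⟶ A) (i : I) :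
    Over (A.obj i) ⥤ UnderDiagram B i :=
  UnderDiagram.const A i ⋙ Over.pullback (Functor.whiskerLeft (Under.forget i) p)

theorem isPullback_app {J : Type*} [Category J] {X A B : J ⥤ C} (a : X ⟶ A) (p : B ⟶ A) (j : J) :
    IsPullback ((pullback.fst a p).app j) ((pullback.snd a p).app j) (a.app j) (p.app j) :=
  (IsPullback.of_hasPullback a p).map ((evaluation J C).obj j)

/-- The projection `X ×_{A_j} B_j ⟶ X`. -/
noncomputable def UnderDiagram.baseChangeFst (p : B ⟶ A) (f : Under i) (X : Over (A.obj i)) :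
    ((UnderDiagram.baseChange p i).obj X).left.obj f ⟶ X.left :=
  (pullback.fst ((UnderDiagram.const A i).obj X).hom
    (Functor.whiskerLeft (Under.forget i) p)).app f

theorem UnderDiagram.isPullback_baseChange (p : B ⟶ A) (f : Under i) (X : Over (A.obj i)) :
    IsPullback (baseChangeFst p f X) (((baseChange p i).obj X).proj f) (X.hom ≫ A.map f.hom)
      (p.app f.right) :=
  isPullback_app ((UnderDiagram.const A i).obj X).hom (Functor.whiskerLeft (Under.forget i) p) f

theorem UnderDiagram.baseChange_map_comp_fst (p : B ⟶ A) (X : Over (A.obj i)) {f g : Under i}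
    (a : f ⟶ g) :
    ((UnderDiagram.baseChange p i).obj X).left.map a ≫ baseChangeFst p g X =
      baseChangeFst p f X :=
  ((pullback.fst ((UnderDiagram.const A i).obj X).hom
    (Functor.whiskerLeft (Under.forget i) p)).naturality a).trans (Category.comp_id _)

theorem UnderDiagram.baseChange_app_comp_fst (p : B ⟶ A) (f : Under i) {X X' : Over (A.obj i)}
    (t : X' ⟶ X) :
    ((UnderDiagram.baseChange p i).map t).left.app f ≫ baseChangeFst p f X =
      baseChangeFst p f X' ≫ t.left :=
  congr_app (pullback.lift_fst _ _ _ : ((UnderDiagram.baseChange p i).map t).left ≫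
    pullback.fst ((UnderDiagram.const A i).obj X).hom _ = _) f

namespace PartialLift

variable {X X' : Over (A.obj i)} (σ τ : PartialLift k S ((UnderDiagram.baseChange p i).obj X))

/-- The value at `f : i ⟶ j` of a partial lift of `X ×_A B`, on generalized elements of `X` and of
`B_j` with the same image in `A_j`. -/
noncomputable def apply (f : i ⟶ j) (hf : Under.mk f ∈ S) {Z : C} (x : Z ⟶ X.left)
    (y : Z ⟶ B.obj j) (w : x ≫ X.hom ≫ A.map f = y ≫ p.app j) : Z ⟶ K.obj j :=
  (UnderDiagram.isPullback_baseChange p (Under.mk f) X).lift x y w ≫ σ.fam (Under.mk f) hf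

theorem fam_eq_apply (f : Under i) (hf : f ∈ S) :
    σ.fam f hf = σ.apply f.hom hf (UnderDiagram.baseChangeFst p f X)
      (((UnderDiagram.baseChange p i).obj X).proj f)
      (UnderDiagram.isPullback_baseChange p f X).w := by
  refine (Category.id_comp _).symm.trans (congr_arg (· ≫ σ.fam f hf) ?_)
  exact (UnderDiagram.isPullback_baseChange p f X).hom_ext
    ((Category.id_comp _).trans (IsPullback.lift_fst _ _ _ _).symm)
    ((Category.id_comp _).trans (IsPullback.lift_snd _ _ _ _).symm)

variable {σ τ} in
theorem ext_apply (h : ∀ ⦃j⦄ (f : i ⟶ j) hf ⦃Z⦄ (x : Z ⟶ X.left) y w,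
    σ.apply f hf x y w = τ.apply f hf x y w) : σ = τ := by
  ext f hf
  rw [fam_eq_apply, fam_eq_apply]
  exact h _ _ _ _ _

variable {f : i ⟶ j} (hf : Under.mk f ∈ S) {Z : C} {x : Z ⟶ X.left} {y : Z ⟶ B.obj j}
  (w : x ≫ X.hom ≫ A.map f = y ≫ p.app j)

theorem apply_comp : σ.apply f hf x y w ≫ k.app j = y :=
  (Category.assoc _ _ _).trans <| (congr_arg (_ ≫ ·) (σ.fam_comp _ hf)).trans <|
    IsPullback.lift_snd _ _ _ _

theorem apply_congr {f' : i ⟶ j} (h : f = f') {x' : Z ⟶ X.left} (hx : x = x') {y' : Z ⟶ B.obj j}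
    (hy : y = y') :
    σ.apply f hf x y w = σ.apply f' (h ▸ hf) x' y' (h ▸ hx ▸ hy ▸ w) := by
  subst h hx hy
  rfl

theorem comp_apply {Z' : C} (z : Z' ⟶ Z) :
    z ≫ σ.apply f hf x y w = σ.apply f hf (z ≫ x) (z ≫ y)
      (by rw [Category.assoc, w, Category.assoc]) := by
  refine (Category.assoc _ _ _).symm.trans (congr_arg (· ≫ σ.fam _ hf) ?_)
  exact (UnderDiagram.isPullback_baseChange p _ X).hom_ext (by simp) (by simp)

theorem apply_map (g : j ⟶ l) (hfg : Under.mk (f ≫ g) ∈ S) :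
    σ.apply f hf x y w ≫ K.map g = σ.apply (f ≫ g) hfg x (y ≫ B.map g)
      (by rw [A.map_comp, reassoc_of% w, Category.assoc, p.naturality]) := by
  let a : Under.mk f ⟶ Under.mk (f ≫ g) := Under.homMk g
  refine (Category.assoc _ _ _).trans ((congr_arg (_ ≫ ·) (σ.fam_map a hf hfg)).trans ?_)
  refine (Category.assoc _ _ _).symm.trans (congr_arg (· ≫ σ.fam _ hfg) ?_)
  refine (UnderDiagram.isPullback_baseChange p _ X).hom_ext ?_ ?_
  · simp [UnderDiagram.baseChange_map_comp_fst]
  · simp [UnderDiagram.map_comp_proj, a]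

theorem apply_pull (t : X' ⟶ X) {x : Z ⟶ X'.left} (w : x ≫ X'.hom ≫ A.map f = y ≫ p.app j) :
    (σ.pull ((UnderDiagram.baseChange p i).map t)).apply f hf x y w =
      σ.apply f hf (x ≫ t.left) y (by rw [Category.assoc, Over.w_assoc, w]) := by
  refine (Category.assoc _ _ _).symm.trans (congr_arg (· ≫ σ.fam _ hf) ?_)
  refine (UnderDiagram.isPullback_baseChange p _ X).hom_ext ?_ ?_
  · simp [UnderDiagram.baseChange_app_comp_fst]
  · simp [UnderDiagram.app_comp_proj]

end PartialLift

end BaseChange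

section OverApp

variable {I : Type u₁} [Category.{v₁} I] {C : Type u₂} [Category.{v₂} C] {A : I ⥤ C}

/-- The component at `i` of a map of diagrams over `A`. -/
def overApp {X X' : Over A} (s : X' ⟶ X) (i : I) :
    Over.mk (X'.hom.app i) ⟶ Over.mk (X.hom.app i) :=
  Over.homMk (s.left.app i) (congr_app (Over.w s) i)

theorem overApp_left {X X' : Over A} (s : X' ⟶ X) (i : I) : (overApp s i).left = s.left.app i := rfl

end OverApp

/-! ### Pushforwards of diagrams -/

section PointwiseUniversal

variable {I : Type u₁} [Category.{v₁} I] {C : Type u₂} [Category.{v₂} C] [HasPullbacks C]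
  {A B K : I ⥤ C} {p : B ⟶ A} {k : K ⟶ B} {i j l : I} {S : Set (Under i)}

section Evaluation

variable {X X' : Over A} (v v' : (Over.pullback p).obj X ⟶ Over.mk k)

/-- The value at `j` of a map `X ×_A B ⟶ K`, on generalized elements of `X_j` and `B_j` with the
same image in `A_j`. -/
noncomputable def homApply {Z : C} (x : Z ⟶ X.left.obj j) (y : Z ⟶ B.obj j)
    (w : x ≫ X.hom.app j = y ≫ p.app j) : Z ⟶ K.obj j :=
  (isPullback_app X.hom p j).lift x y w ≫ v.left.app j

theorem app_eq_homApply (j : I) :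
    v.left.app j = homApply v ((pullback.fst X.hom p).app j) ((pullback.snd X.hom p).app j)
      (isPullback_app X.hom p j).w := by
  refine (Category.id_comp _).symm.trans (congr_arg (· ≫ v.left.app j) ?_)
  exact (isPullback_app X.hom p j).hom_ext
    ((Category.id_comp _).trans (IsPullback.lift_fst _ _ _ _).symm)
    ((Category.id_comp _).trans (IsPullback.lift_snd _ _ _ _).symm)

variable {v v'} in
theorem hom_ext_homApply (h : ∀ ⦃j Z⦄ (x : Z ⟶ X.left.obj j) y w,
    homApply v x y w = homApply v' x y w) : v = v' := by
  refine Over.OverMorphism.ext (NatTrans.ext (funext fun j => ?_))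
  rw [app_eq_homApply, app_eq_homApply]
  exact h _ _ _

variable {Z : C} {x : Z ⟶ X.left.obj j} {y : Z ⟶ B.obj j} (w : x ≫ X.hom.app j = y ≫ p.app j)

theorem homApply_comp : homApply v x y w ≫ k.app j = y :=
  (Category.assoc _ _ _).trans <| (congr_arg (_ ≫ ·) (congr_app (Over.w v) j)).trans <|
    IsPullback.lift_snd _ _ _ _

theorem homApply_congr {x' : Z ⟶ X.left.obj j} (hx : x = x') :
    homApply v x y w = homApply v x' y (hx ▸ w) := by
  subst hx
  rfl

theorem comp_homApply {Z' : C} (z : Z' ⟶ Z) :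
    z ≫ homApply v x y w = homApply v (z ≫ x) (z ≫ y)
      (by rw [Category.assoc, w, Category.assoc]) := by
  refine (Category.assoc _ _ _).symm.trans (congr_arg (· ≫ v.left.app j) ?_)
  exact (isPullback_app X.hom p j).hom_ext (by simp) (by simp)

theorem homApply_map (g : j ⟶ l) :
    homApply v x y w ≫ K.map g = homApply v (x ≫ X.left.map g) (y ≫ B.map g)
      (by rw [Category.assoc, X.hom.naturality, reassoc_of% w, Category.assoc, p.naturality]) := by
  refine (Category.assoc _ _ _).trans ((congr_arg (_ ≫ ·) (v.left.naturality g).symm).trans ?_)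
  refine (Category.assoc _ _ _).symm.trans (congr_arg (· ≫ v.left.app l) ?_)
  exact (isPullback_app X.hom p l).hom_ext (by simp) (by simp)

theorem homApply_pullback_map_comp (t : X' ⟶ X) {x : Z ⟶ X'.left.obj j}
    (w : x ≫ X'.hom.app j = y ≫ p.app j) :
    homApply ((Over.pullback p).map t ≫ v) x y w = homApply v (x ≫ t.left.app j) y
      (by rw [Category.assoc, ← NatTrans.comp_app, Over.w, w]) := by
  refine (Category.assoc _ _ _).symm.trans (congr_arg (· ≫ v.left.app j) ?_)
  have hfst := congr_app (pullback.lift_fst _ _ _ :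
    ((Over.pullback p).map t).left ≫ pullback.fst X.hom p = pullback.fst X'.hom p ≫ t.left) j
  have hsnd := congr_app (Over.w ((Over.pullback p).map t)) j
  refine (isPullback_app X.hom p j).hom_ext ?_ ?_
  · refine (Category.assoc _ _ _).trans ((congr_arg (_ ≫ ·) hfst).trans ?_)
    rw [IsPullback.lift_fst, NatTrans.comp_app, IsPullback.lift_fst_assoc]
  · refine (Category.assoc _ _ _).trans ((congr_arg (_ ≫ ·) hsnd).trans ?_)
    rw [IsPullback.lift_snd]
    exact IsPullback.lift_snd _ _ _ _

end Evaluation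

namespace PartialLift

variable {P : Over A}

/-- The partial lift of `X ×_A B` through `k` corresponding under `v : P ×_A B ⟶ K` to a partial
lift of `X` through `P ⟶ A`. -/
noncomputable def transfer (v : (Over.pullback p).obj P ⟶ Over.mk k) {X : Over (A.obj i)}
    (ζ : PartialLift P.hom S ((UnderDiagram.const A i).obj X)) :
    PartialLift k S ((UnderDiagram.baseChange p i).obj X) where
  fam f hf := homApply v (UnderDiagram.baseChangeFst p f X ≫ ζ.value f hf)
    (((UnderDiagram.baseChange p i).obj X).proj f) (by
      rw [Category.assoc, ζ.value_comp, (UnderDiagram.isPullback_baseChange p f X).w])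
  fam_comp f hf := homApply_comp _ _
  fam_map f g a hf hg := by
    rw [homApply_map, comp_homApply]
    congr 1
    · rw [Category.assoc, ζ.value_map a hf hg, reassoc_of% UnderDiagram.baseChange_map_comp_fst]
    · rw [UnderDiagram.map_comp_proj]

theorem transfer_apply (v : (Over.pullback p).obj P ⟶ Over.mk k) {X : Over (A.obj i)}
    (ζ : PartialLift P.hom S ((UnderDiagram.const A i).obj X)) (f : i ⟶ j) (hf : Under.mk f ∈ S)
    {Z : C} (x : Z ⟶ X.left) (y : Z ⟶ B.obj j) (w : x ≫ X.hom ≫ A.map f = y ≫ p.app j) :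
    (transfer v ζ).apply f hf x y w = homApply v (x ≫ ζ.value (Under.mk f) hf) y
      (by rw [Category.assoc, ζ.value_comp]; exact w) := by
  refine (comp_homApply v _ _).trans ?_
  congr 1
  · exact IsPullback.lift_fst_assoc _ _ _ _ _
  · exact IsPullback.lift_snd _ _ _ _

theorem transfer_pull (v : (Over.pullback p).obj P ⟶ Over.mk k) {X X' : Over (A.obj i)}
    (ζ : PartialLift P.hom S ((UnderDiagram.const A i).obj X)) (t : X' ⟶ X) :
    transfer v (ζ.pull ((UnderDiagram.const A i).map t)) =
      (transfer v ζ).pull ((UnderDiagram.baseChange p i).map t) := by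
  refine ext_apply fun j f hf Z x y w => ?_
  rw [apply_pull, transfer_apply, transfer_apply]
  simp only [value_pull, Category.assoc]

variable {X : Over (A.obj i)}

/-- The partial lift at `j` obtained from a partial lift at `i` and a map `g : i ⟶ j` on which it is
defined. -/
noncomputable def push (τ : PartialLift k S ((UnderDiagram.baseChange p i).obj X)) (g : i ⟶ j)
    (hS : IsCosieve S) (hg : Under.mk g ∈ S) :
    PartialLift k Set.univ ((UnderDiagram.baseChange p j).obj ((Over.map (A.map g)).obj X)) where
  fam f _ := τ.apply (g ≫ f.hom) (hS hg (Under.homMk f.hom)) (UnderDiagram.baseChangeFst p f _)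
    (((UnderDiagram.baseChange p j).obj _).proj f) (by
      rw [← (UnderDiagram.isPullback_baseChange p f ((Over.map (A.map g)).obj X)).w]
      simp)
  fam_comp f _ := τ.apply_comp _ _
  fam_map f f' a _ _ := by
    have hS' : Under.mk (g ≫ f'.hom) ∈ S := hS hg (Under.homMk f'.hom)
    have ha : (g ≫ f.hom) ≫ a.right = g ≫ f'.hom := by rw [Category.assoc, Under.w]
    rw [apply_map (hfg := ha ▸ hS'), comp_apply]
    exact apply_congr _ _ _ ha (UnderDiagram.baseChange_map_comp_fst p _ a).symm
      (UnderDiagram.map_comp_proj ((UnderDiagram.baseChange p j).obj _) a).symm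

theorem push_apply (τ : PartialLift k S ((UnderDiagram.baseChange p i).obj X)) (g : i ⟶ j)
    (hS : IsCosieve S) (hg : Under.mk g ∈ S) (f : j ⟶ l) (hf : Under.mk f ∈ Set.univ) {Z : C}
    (x : Z ⟶ X.left) (y : Z ⟶ B.obj l) (w : x ≫ (X.hom ≫ A.map g) ≫ A.map f = y ≫ p.app l) :
    (τ.push g hS hg).apply f hf x y w =
      τ.apply (g ≫ f) (hS hg (Under.homMk f)) x y (by simpa using w) :=
  (comp_apply _ _ _ _).trans
    (apply_congr _ _ _ rfl (IsPullback.lift_fst _ _ _ _) (IsPullback.lift_snd _ _ _ _))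

namespace IsUniversal

variable {T : Over (A.obj j)} {σ : PartialLift k Set.univ ((UnderDiagram.baseChange p j).obj T)}

theorem hom_ext_apply (h : σ.IsUniversal (UnderDiagram.baseChange p j)) {Z : C}
    {t t' : Z ⟶ T.left} (ht : t ≫ T.hom = t' ≫ T.hom)
    (hσ : ∀ ⦃l⦄ (f : j ⟶ l) ⦃Y⦄ (x : Y ⟶ Z) y w w',
      σ.apply f (Set.mem_univ _) (x ≫ t) y w = σ.apply f (Set.mem_univ _) (x ≫ t') y w') :
    t = t' := by
  let s : Over.mk (t' ≫ T.hom) ⟶ T := Over.homMk t ht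
  let s' : Over.mk (t' ≫ T.hom) ⟶ T := Over.homMk t'
  suffices s = s' from congr_arg (·.left) this
  refine h.hom_ext (ext_apply fun l f hf Y x y w => ?_)
  rw [apply_pull, apply_pull]
  exact hσ f x y _ _

theorem exists_apply_eq_apply_comp (h : σ.IsUniversal (UnderDiagram.baseChange p j))
    (τ : PartialLift k S ((UnderDiagram.baseChange p i).obj X)) (g : i ⟶ j) (hS : IsCosieve S)
    (hg : Under.mk g ∈ S) :
    ∃ t : X.left ⟶ T.left, t ≫ T.hom = X.hom ≫ A.map g ∧
      ∀ ⦃l⦄ (f : j ⟶ l) ⦃Z⦄ (x : Z ⟶ X.left) y w w',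
        σ.apply f (Set.mem_univ _) (x ≫ t) y w =
          τ.apply (g ≫ f) (hS hg (Under.homMk f)) x y w' := by
  obtain ⟨t, ht, -⟩ := h _ (τ.push g hS hg)
  refine ⟨t.left, Over.w t, fun l f Z x y w w' => ?_⟩
  have hw : x ≫ (X.hom ≫ A.map g) ≫ A.map f = y ≫ p.app l := by simpa using w'
  rw [← push_apply τ g hS hg f (Set.mem_univ _) x y hw, ← ht, apply_pull]

end IsUniversal

/-- The partial lift at `i` given by a map `X ×_A B ⟶ K`. -/
noncomputable def ofHom {X : Over A} (v : (Over.pullback p).obj X ⟶ Over.mk k) (i : I) :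
    PartialLift k Set.univ ((UnderDiagram.baseChange p i).obj (Over.mk (X.hom.app i))) :=
  transfer v (const (𝟙 _))

variable {X X' : Over A}

theorem ofHom_apply (v : (Over.pullback p).obj X ⟶ Over.mk k) (f : i ⟶ j)
    (hf : Under.mk f ∈ Set.univ) {Z : C} (x : Z ⟶ X.left.obj i) (y : Z ⟶ B.obj j)
    (w : x ≫ X.hom.app i ≫ A.map f = y ≫ p.app j) :
    (ofHom v i).apply f hf x y w = homApply v (x ≫ X.left.map f) y
      (by rw [Category.assoc, X.hom.naturality, w]) :=
  (transfer_apply v (const (𝟙 (Over.mk (X.hom.app i)))) f hf x y w).trans <|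
    homApply_congr v _ (congr_arg (x ≫ ·) (Category.id_comp (X.left.map f)))

theorem ofHom_apply_id (v : (Over.pullback p).obj X ⟶ Over.mk k) {Z : C} (x : Z ⟶ X.left.obj i)
    (y : Z ⟶ B.obj i) (w : x ≫ X.hom.app i ≫ A.map (𝟙 i) = y ≫ p.app i) :
    (ofHom v i).apply (𝟙 i) (Set.mem_univ _) x y w = homApply v x y (by simpa using w) :=
  (ofHom_apply v _ _ _ _ _).trans <| homApply_congr v _ (by simp)

theorem ofHom_pullback_map_comp (v : (Over.pullback p).obj X ⟶ Over.mk k) (s : X' ⟶ X) (i : I) :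
    ofHom ((Over.pullback p).map s ≫ v) i =
      (ofHom v i).pull ((UnderDiagram.baseChange p i).map (overApp s i)) := by
  refine ext_apply fun j f hf Z x y w => ?_
  rw [apply_pull, ofHom_apply, ofHom_apply, homApply_pullback_map_comp]
  exact homApply_congr v _ (by simp [overApp_left])

end PartialLift

/-- A map `P ×_A B ⟶ K` is *pointwise universal* if it makes `P_i` represent the partial lifts
through `k` of the diagrams `X ×_A B` on all of `i/I`. -/
def IsPointwiseUniversal {P : Over A} (v : (Over.pullback p).obj P ⟶ Over.mk k) : Prop :=
  ∀ i, (PartialLift.ofHom v i).IsUniversal (UnderDiagram.baseChange p i)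

namespace IsPointwiseUniversal

variable {P : Over A} {v : (Over.pullback p).obj P ⟶ Over.mk k}

theorem hom_ext (h : IsPointwiseUniversal v) {Z : C} {t t' : Z ⟶ P.left.obj i}
    (ht : t ≫ P.hom.app i = t' ≫ P.hom.app i)
    (hv : ∀ ⦃j⦄ (f : i ⟶ j) ⦃Y⦄ (x : Y ⟶ Z) y w w',
      homApply v (x ≫ t ≫ P.left.map f) y w = homApply v (x ≫ t' ≫ P.left.map f) y w') :
    t = t' := by
  refine (h i).hom_ext_apply ht fun j f Y x y w w' => ?_
  rw [PartialLift.ofHom_apply, PartialLift.ofHom_apply]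
  exact (homApply_congr v _ (Category.assoc _ _ _)).trans <|
    (hv f x y (by simpa using w) (by simpa using w')).trans
      (homApply_congr v _ (Category.assoc _ _ _).symm)

theorem exists_homApply_eq (h : IsPointwiseUniversal v) {X : Over (A.obj i)}
    (τ : PartialLift k S ((UnderDiagram.baseChange p i).obj X)) (g : i ⟶ j) (hS : IsCosieve S)
    (hg : Under.mk g ∈ S) :
    ∃ t : X.left ⟶ P.left.obj j, t ≫ P.hom.app j = X.hom ≫ A.map g ∧
      ∀ ⦃l⦄ (f : j ⟶ l) ⦃Z⦄ (x : Z ⟶ X.left) y w w',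
        homApply v (x ≫ t ≫ P.left.map f) y w = τ.apply (g ≫ f) (hS hg (Under.homMk f)) x y w' := by
  obtain ⟨t, ht, hτ⟩ := (h j).exists_apply_eq_apply_comp τ g hS hg
  refine ⟨t, ht, fun l f Z x y w w' => ?_⟩
  rw [← hτ f x y (by simpa using w) w', PartialLift.ofHom_apply]
  exact homApply_congr v _ (Category.assoc _ _ _).symm

theorem existsUnique_overApp (h : IsPointwiseUniversal v) {X : Over A}
    (u : (Over.pullback p).obj X ⟶ Over.mk k) :
    ∃! s : X ⟶ P, ∀ i, (PartialLift.ofHom v i).pull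
      ((UnderDiagram.baseChange p i).map (overApp s i)) = PartialLift.ofHom u i := by
  choose t ht ht' using fun i => h i _ (PartialLift.ofHom u i)
  have hw (i : I) : (t i).left ≫ P.hom.app i = X.hom.app i := Over.w (t i)
  have hv {i j : I} (f : i ⟶ j) {Z : C} (x : Z ⟶ X.left.obj i) (y) {a} {b}
      (ha : a = x ≫ (t i).left ≫ P.left.map f) (hb : b = x ≫ X.left.map f) (w w') :
      homApply v a y w = homApply u b y w' := by
    subst ha hb
    have hx : x ≫ X.hom.app i ≫ A.map f = y ≫ p.app j := by simpa using w'
    rw [← PartialLift.ofHom_apply u f (Set.mem_univ _) x y hx, ← ht, PartialLift.apply_pull,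
      PartialLift.ofHom_apply]
    exact homApply_congr v _ (Category.assoc _ _ _).symm
  let s : X ⟶ P := Over.homMk
    { app i := (t i).left
      naturality i j g := by
        refine h.hom_ext ?_ fun l f Y x y w w' => ?_
        · simp [hw, reassoc_of% hw]
        · have hx : (x ≫ X.left.map g ≫ X.left.map f) ≫ X.hom.app l = y ≫ p.app l := by
            simpa [reassoc_of% hw] using w
          exact (hv f (x ≫ X.left.map g) y (by simp) (by simp) _ hx).trans
            (hv (g ≫ f) x y (by simp) (by simp) _ hx).symm }
    (NatTrans.ext (funext hw))
  refine ⟨s, ht, fun s' hs' => Over.OverMorphism.ext (NatTrans.ext (funext fun i => ?_))⟩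
  exact congr_arg (·.left) (ht' i (overApp s' i) (hs' i))

theorem isPushforward (h : IsPointwiseUniversal v) : IsPushforward p (Over.mk k) P v := by
  intro X u
  obtain ⟨s, hs, hs'⟩ := h.existsUnique_overApp u
  refine ⟨s, hom_ext_homApply fun j Z x y w => ?_, fun s' h' => hs' s' fun i => ?_⟩
  · rw [← PartialLift.ofHom_apply_id _ x y (by simpa using w),
      PartialLift.ofHom_pullback_map_comp, hs, PartialLift.ofHom_apply_id]
  · rw [← PartialLift.ofHom_pullback_map_comp, h']

end IsPointwiseUniversal

open PartialLift

theorem PartialLift.exists_ofHom_eq {P : Over A}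
    (σ : ∀ i, PartialLift k Set.univ ((UnderDiagram.baseChange p i).obj (Over.mk (P.hom.app i))))
    (hσ : ∀ ⦃i j l⦄ (g : i ⟶ j) (f : j ⟶ l) ⦃Z⦄ (x : Z ⟶ P.left.obj i) y w w',
      (σ j).apply f (Set.mem_univ _) (x ≫ P.left.map g) y w =
        (σ i).apply (g ≫ f) (Set.mem_univ _) x y w') :
    ∃ v : (Over.pullback p).obj P ⟶ Over.mk k, ∀ i, ofHom v i = σ i := by
  have hw {j : I} {Z : C} {x : Z ⟶ P.left.obj j} {y : Z ⟶ B.obj j}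
      (w : x ≫ P.hom.app j = y ≫ p.app j) : x ≫ P.hom.app j ≫ A.map (𝟙 j) = y ≫ p.app j := by
    simpa using w
  let v : (Over.pullback p).obj P ⟶ Over.mk k := Over.homMk
    { app j := (σ j).apply (𝟙 j) (Set.mem_univ _) ((pullback.fst P.hom p).app j)
        ((pullback.snd P.hom p).app j) (hw (isPullback_app P.hom p j).w)
      naturality j l g := by
        refine (comp_apply _ _ _ _).trans (Eq.trans ?_ (apply_map _ _ _ g (Set.mem_univ _)).symm)
        have hfst := (pullback.fst P.hom p).naturality g
        have hsnd := (pullback.snd P.hom p).naturality g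
        refine (apply_congr _ _ _ rfl hfst hsnd).trans ((hσ g (𝟙 l) _ _ _ ?_).trans ?_)
        · rw [Category.assoc, p.naturality, Category.comp_id]
          exact (isPullback_app P.hom p j).toCommSq.w_assoc (A.map g)
        · exact apply_congr _ _ _ ((Category.comp_id g).trans (Category.id_comp g).symm) rfl rfl }
    (NatTrans.ext (funext fun j => apply_comp _ _ _))
  have hv {j : I} {Z : C} (x : Z ⟶ P.left.obj j) (y w) :
      homApply v x y w = (σ j).apply (𝟙 j) (Set.mem_univ _) x y (hw w) :=
    (comp_apply _ _ _ _).trans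
      (apply_congr _ _ _ rfl (IsPullback.lift_fst _ _ _ _) (IsPullback.lift_snd _ _ _ _))
  refine ⟨v, fun i => ext_apply fun j f hf Z x y w => ?_⟩
  rw [ofHom_apply, hv, hσ f (𝟙 j) x y _ (by simpa using w)]
  exact apply_congr _ _ _ (Category.comp_id f) rfl rfl

theorem exists_isPointwiseUniversal {T : ∀ i, Over (A.obj i)}
    {σ : ∀ i, PartialLift k Set.univ ((UnderDiagram.baseChange p i).obj (T i))}
    (hσ : ∀ i, (σ i).IsUniversal (UnderDiagram.baseChange p i)) :
    ∃ (P : Over A) (v : (Over.pullback p).obj P ⟶ Over.mk k), IsPointwiseUniversal v := by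
  choose m hm hσm using fun {i j} (g : i ⟶ j) =>
    (hσ j).exists_apply_eq_apply_comp (σ i) g (isCosieve_univ i) (Set.mem_univ _)
  let P : Over A := Over.mk (Y :=
    { obj i := (T i).left
      map := m
      map_id i := by
        refine (hσ i).hom_ext_apply ?_ fun l f Y x y w w' => ?_
        · simp [hm]
        · have hx : x ≫ (T i).hom ≫ A.map (𝟙 i ≫ f) = y ≫ p.app l := by simpa using w'
          exact (hσm (𝟙 i) f x y w hx).trans
            (apply_congr _ _ _ (Category.id_comp f) (Category.comp_id x).symm rfl)
      map_comp {i j l} f g := by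
        refine (hσ l).hom_ext_apply ?_ fun l' f' Y x y w w' => ?_
        · simp [hm, reassoc_of% hm]
        · have hx : x ≫ (T i).hom ≫ A.map ((f ≫ g) ≫ f') = y ≫ p.app l' := by
            simpa [reassoc_of% hm] using w
          refine (hσm (f ≫ g) f' x y w hx).trans ?_
          refine (apply_congr _ _ _ (Category.assoc f g f') rfl rfl).trans ?_
          refine (hσm f (g ≫ f') x y (by simpa [reassoc_of% hm] using hx) _).symm.trans ?_
          refine (hσm g f' (x ≫ m f) y (by simpa using w') _).symm.trans ?_
          exact apply_congr _ _ _ rfl (Category.assoc _ _ _) rfl })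
    { app i := (T i).hom
      naturality i j g := hm g }
  obtain ⟨v, hv⟩ := exists_ofHom_eq (P := P) σ fun i j l g f Z x y w w' => hσm g f x y w w'
  exact ⟨P, v, fun i => by rw [hv]; exact hσ i⟩

theorem IsPushforward.isPointwiseUniversal {P Q : Over A} {ev : (Over.pullback p).obj Q ⟶ Over.mk k}
    (h : IsPushforward p (Over.mk k) Q ev) {v : (Over.pullback p).obj P ⟶ Over.mk k}
    (hv : IsPointwiseUniversal v) : IsPointwiseUniversal ev := by
  obtain ⟨s, hs, -⟩ := h P v
  obtain ⟨s', hs', -⟩ := hv.isPushforward Q ev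
  have hss : s' ≫ s = 𝟙 Q := (h Q ev).unique (by simp [hs, hs']) (by simp)
  have hss' : s ≫ s' = 𝟙 P := (hv.isPushforward P v).unique (by simp [hs, hs']) (by simp)
  intro i
  have : IsIso (overApp s' i) := ⟨overApp s i,
    Over.OverMorphism.ext (congr_app (congr_arg (·.left) hss) i),
    Over.OverMorphism.ext (congr_app (congr_arg (·.left) hss') i)⟩
  rw [← hs', ofHom_pullback_map_comp]
  exact (hv i).pull_isIso _

namespace IsPointwiseUniversal

variable {P : Over A} {v : (Over.pullback p).obj P ⟶ Over.mk k}

theorem transfer_injective (hv : IsPointwiseUniversal v) (hS : IsCosieve S) (X : Over (A.obj i)) :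
    Function.Injective (transfer v :
      PartialLift P.hom S ((UnderDiagram.const A i).obj X) → _) := by
  refine fun ζ ζ' h => ext_value fun f hf => ?_
  refine hv.hom_ext ((ζ.value_comp f hf).trans (ζ'.value_comp f hf).symm) fun l g Z x y w w' => ?_
  have hfg : Under.mk (f.hom ≫ g) ∈ S := hS hf (Under.homMk g)
  let a : f ⟶ Under.mk (f.hom ≫ g) := Under.homMk g
  have hx : x ≫ X.hom ≫ A.map (f.hom ≫ g) = y ≫ p.app l := by
    simpa [reassoc_of% ζ.value_comp] using w
  have hζ := congr_arg (fun τ => apply τ _ hfg x y hx) h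
  rw [transfer_apply, transfer_apply] at hζ
  exact ((homApply_congr v _ (congr_arg (x ≫ ·) (ζ.value_map a hf hfg))).trans hζ).trans
    (homApply_congr v _ (congr_arg (x ≫ ·) (ζ'.value_map a hf hfg))).symm

theorem transfer_surjective (hv : IsPointwiseUniversal v) (hS : IsCosieve S) (X : Over (A.obj i)) :
    Function.Surjective (transfer v :
      PartialLift P.hom S ((UnderDiagram.const A i).obj X) → _) := by
  intro τ
  choose t ht hτ using fun (f : Under i) (hf : f ∈ S) => hv.exists_homApply_eq τ f.hom hS hf
  let ζ : PartialLift P.hom S ((UnderDiagram.const A i).obj X) := by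
    refine ofValues t ht fun f g a hf hg => hv.hom_ext ?_ fun l b Z x y w w' => ?_
    · rw [ht, Category.assoc, P.hom.naturality, reassoc_of% ht, ← A.map_comp, Under.w]
    · have hx : x ≫ X.hom ≫ A.map (g.hom ≫ b) = y ≫ p.app l := by
        simpa [reassoc_of% ht] using w'
      have hfab : f.hom ≫ a.right ≫ b = g.hom ≫ b := Under.w_assoc a b
      refine Eq.trans ?_ (hτ g hg b x y w' hx).symm
      refine (homApply_congr v _ (by simp)).trans ((hτ f hf (a.right ≫ b) x y ?_ ?_).trans
        (apply_congr _ _ _ hfab rfl rfl))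
      · simpa using w
      · simpa [hfab] using hx
  refine ⟨ζ, ext_apply fun j f hf Z x y w => ?_⟩
  have hid : t (Under.mk f) hf ≫ P.left.map (𝟙 j) = t (Under.mk f) hf :=
    (congr_arg (_ ≫ ·) (P.left.map_id j)).trans (Category.comp_id _)
  have hx : (x ≫ t (Under.mk f) hf ≫ P.left.map (𝟙 j)) ≫ P.hom.app j = y ≫ p.app j := by
    have htf : t (Under.mk f) hf ≫ P.hom.app j = X.hom ≫ A.map f := ht _ hf
    simpa [htf] using w
  calc (transfer v ζ).apply f hf x y w
    _ = homApply v (x ≫ t (Under.mk f) hf) y _ := transfer_apply v ζ f hf x y w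
    _ = homApply v (x ≫ t (Under.mk f) hf ≫ P.left.map (𝟙 j)) y hx :=
        homApply_congr v _ (congr_arg (x ≫ ·) hid.symm)
    _ = τ.apply (f ≫ 𝟙 j) _ x y _ := hτ _ hf (𝟙 j) x y hx (by simpa using w)
    _ = τ.apply f hf x y w := apply_congr _ _ _ (Category.comp_id f) rfl rfl

theorem transfer_bijective (hv : IsPointwiseUniversal v) (hS : IsCosieve S) (X : Over (A.obj i)) :
    Function.Bijective (transfer v :
      PartialLift P.hom S ((UnderDiagram.const A i).obj X) → _) :=
  ⟨hv.transfer_injective hS X, hv.transfer_surjective hS X⟩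

theorem transfer_isUniversal (hv : IsPointwiseUniversal v) (hS : IsCosieve S) {X : Over (A.obj i)}
    {ζ : PartialLift P.hom S ((UnderDiagram.const A i).obj X)}
    (hζ : ζ.IsUniversal (UnderDiagram.const A i)) :
    (transfer v ζ).IsUniversal (UnderDiagram.baseChange p i) := by
  refine fun X' => (hv.transfer_bijective hS X').surjective.forall.2 fun ζ' => ?_
  simpa only [← transfer_pull, (hv.transfer_bijective hS X').injective.eq_iff] using hζ X' ζ'

end IsPointwiseUniversal

end PointwiseUniversal

namespace UnderDiagram

variable {I : Type u₁} [Category.{v₁} I] {C : Type u₂} [Category.{v₂} C] [HasPullbacks C]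
  {A B : I ⥤ C} {p : B ⟶ A} {i : I}

theorem isCartesianFamily_baseChangeFst (p : B ⟶ A) (f : Under i) :
    IsCartesianFamily (G := baseChange p i ⋙ eval B f) (baseChangeFst p f) :=
  .of_isPullback (isPullback_baseChange p f) (fun _ _ a => baseChange_app_comp_fst p f a)
    fun _ _ a => app_comp_proj ((baseChange p i).map a) f

theorem fibration_baseChangeFst {F : MorphismProperty C} [F.IsStableUnderBaseChange]
    {f : Under i} (hp : F (p.app f.right)) (X : Over (A.obj i)) : F (baseChangeFst p f X) :=
  F.of_isPullback (isPullback_baseChange p f X).flip hp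

theorem liftsFibrations_baseChange {F : MorphismProperty C} [F.IsStableUnderBaseChange]
    (hF : FibrationsStableUnderPushforward F) {f : Under i} (hp : F (p.app f.right)) :
    LiftsFibrations F (baseChange p i ⋙ eval B f) :=
  (isCartesianFamily_baseChangeFst p f).liftsFibrations hF (fibration_baseChangeFst hp)

end UnderDiagram

/-! ### Relative matching maps -/

section RelativeMatching

variable {I : Type u₁} [Category.{v₁} I] {C : Type u₂} [Category.{v₂} C] [HasFiniteLimits C]
  [∀ i : I, Finite (Under i)] {A B K : I ⥤ C} {p : B ⟶ A} {k : K ⟶ B} {i : I}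

namespace PartialLift

/-- The tautological partial lift on `∂(i/I)` of the constant diagram at `B_i ×_{M_i B} M_i K`. -/
noncomputable def matching (k : K ⟶ B) (i : I) : PartialLift k {f : Under i | boundaryProp i f}
    ((UnderDiagram.const B i).obj
      (Over.mk (pullback.fst (matchingMap B i) (matchingObjMap k i)))) :=
  ofValues (fun f hf => pullback.snd _ _ ≫ matchingProj K i ⟨f, hf⟩)
    (fun f hf => by
      rw [Category.assoc, ← matchingObjMap_proj, ← pullback.condition_assoc, matchingMap_proj]
      rfl)
    (fun f g a hf hg => (Category.assoc _ _ _).trans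
      (congr_arg (_ ≫ ·) (matchingProj_map K i (b := ⟨f, hf⟩) (b' := ⟨g, hg⟩) ⟨a⟩)))

theorem matching_value (k : K ⟶ B) (i : I) (f : Under i) (hf : boundaryProp i f) :
    (matching k i).value f hf = pullback.snd _ _ ≫ matchingProj K i ⟨f, hf⟩ := rfl

theorem matching_isUniversal (k : K ⟶ B) (i : I) :
    (matching k i).IsUniversal (UnderDiagram.const B i) := by
  intro X ζ
  let z : X.left ⟶ matchingObj K i := matchingLift (fun b => ζ.value b.obj b.property)
    fun b b' a => ζ.value_map a.hom b.property b'.property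
  have hz (b : Boundary i) : z ≫ matchingProj K i b = ζ.value b.obj b.property :=
    matchingLift_proj _ _ b
  let l : X.left ⟶ pullback (matchingMap B i) (matchingObjMap k i) :=
    pullback.lift X.hom z <| matchingObj_hom_ext fun b => by
      rw [Category.assoc, Category.assoc, matchingMap_proj, matchingObjMap_proj,
        reassoc_of% hz b, ζ.value_comp]
  have hl (b : Boundary i) : l ≫ pullback.snd _ _ ≫ matchingProj K i b =
      ζ.value b.obj b.property := (pullback.lift_snd_assoc _ _ _ _).trans (hz b)
  refine ⟨Over.homMk l (pullback.lift_fst _ _ _), ext_value fun f hf => ?_, fun t ht => ?_⟩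
  · exact hl ⟨f, hf⟩
  · refine Over.OverMorphism.ext (pullback.hom_ext ?_ (matchingObj_hom_ext fun b => ?_))
    · exact (Over.w t).trans (pullback.lift_fst _ _ _).symm
    · have htb : t.left ≫ pullback.snd _ _ ≫ matchingProj K i b = ζ.value b.obj b.property :=
        congr_arg (fun ζ : PartialLift k _ _ => ζ.value b.obj b.property) ht
      exact (Category.assoc _ _ _).trans <| htb.trans <|
        (hl b).symm.trans (Category.assoc _ _ _).symm

end PartialLift

namespace IsPointwiseUniversal

open PartialLift

variable {P : Over A} {v : (Over.pullback p).obj P ⟶ Over.mk k}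

/-- The boundary sections are represented by `A_i ×_{M_i A} M_i P`, so that extending them over the
identity of `i` is what the relative matching map of `P` represents. -/
theorem isUniversalLift_relativeMatchingMap (hI : IsInverseCategory I)
    (hv : IsPointwiseUniversal v) (i : I) :
    ∃ (n : _) (ε : _), IsUniversalLift
      (UnderDiagram.baseChange p i ⋙ UnderDiagram.eval B (Under.mk (𝟙 i))) n
      (relativeMatchingMap k i)
      (Over.homMk (relativeMatchingMap P.hom i) (relativeMatchingMap_fst P.hom i) :
        Over.mk (P.hom.app i) ⟶ Over.mk (pullback.fst (matchingMap A i) (matchingObjMap P.hom i)))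
      ε := by
  have hi := hI.isCosieveStep_boundary i
  let r : Over.mk (P.hom.app i) ⟶
      Over.mk (pullback.fst (matchingMap A i) (matchingObjMap P.hom i)) :=
    Over.homMk (relativeMatchingMap P.hom i) (relativeMatchingMap_fst P.hom i)
  have hr : (const (𝟙 (Over.mk (P.hom.app i)))).restrict (Set.subset_univ _) =
      (matching P.hom i).pull ((UnderDiagram.const A i).map r) := by
    refine ext_value fun f hf => ?_
    rw [value_pull, matching_value]
    have h : relativeMatchingMap P.hom i ≫ pullback.snd _ _ ≫ matchingProj P.left i ⟨f, hf⟩ =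
        P.left.map f.hom := by
      rw [← Category.assoc, relativeMatchingMap_snd, matchingMap_proj]
    exact (Category.id_comp _).trans h.symm
  have hβ := hv.transfer_isUniversal hi.closed (matching_isUniversal P.hom i)
  have hτ := (IsUniversal.restrict_iff (insert_id_boundary i)).2 (hv i)
  refine ⟨_, _, (isUniversal_insert_iff hi hβ (r := r) ?_).1 hτ⟩
  rw [← transfer_pull, ← hr]
  rfl

variable {F : MorphismProperty C} [F.IsStableUnderBaseChange]

theorem isReedyFibration (hI : IsInverseCategory I) (hF : FibrationsStableUnderPushforward F)
    (hp : ∀ i, F (p.app i)) (hk : IsReedyFibration F k) (hv : IsPointwiseUniversal v) :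
    IsReedyFibration F P.hom := fun i => by
  obtain ⟨n, ε, h⟩ := hv.isUniversalLift_relativeMatchingMap hI i
  exact h.fibration (UnderDiagram.isCartesianFamily_baseChangeFst p _) hF
    (UnderDiagram.fibration_baseChangeFst (hp i) _) (hk i)

theorem weakEquivalence_relativeMatchingMap [F.IsMultiplicative] {W : MorphismProperty C}
    [W.HasTwoOutOfThreeProperty] (hI : IsInverseCategory I)
    (hW : MorphismProperty.isomorphisms C ≤ W) (hpb : PullbacksLogicallyBehaved F W)
    (hpf : PushforwardsLogicallyBehaved F W) (hv : IsPointwiseUniversal v) {i : I}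
    (hp : F (p.app i)) (hk : F (relativeMatchingMap k i)) (hkW : W (relativeMatchingMap k i)) :
    W (relativeMatchingMap P.hom i) := by
  obtain ⟨n, ε, h⟩ := hv.isUniversalLift_relativeMatchingMap hI i
  exact h.weakEquivalence_of_weakEquivalence (UnderDiagram.isCartesianFamily_baseChangeFst p _)
    hW hpb hpf (UnderDiagram.fibration_baseChangeFst hp _) hk hkW

end IsPointwiseUniversal

end RelativeMatching

section InitialBoundary

variable {I : Type u₁} [Category.{v₁} I] {C : Type u₂} [Category.{v₂} C] [HasFiniteLimits C]
  [∀ i : I, Finite (Under i)] {F W : MorphismProperty C} [W.HasTwoOutOfThreeProperty] {i : I}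

theorem isIso_matchingProj (X : I ⥤ C) {b : Boundary i} (hb : IsInitial b) :
    IsIso (matchingProj X i b) :=
  isIso_π_of_isInitial hb (boundaryDiagram X i)

/-- An initial object `b : i ⟶ j` of `∂(i/I)` identifies the matching objects at `i` with the values
at `j`, so that the relative matching map is `E_i ⟶ D_i ×_{D_j} E_j`. -/
theorem weakEquivalence_relativeMatchingMap_iff_of_isInitial {D E : I ⥤ C} {q : E ⟶ D}
    {b : Boundary i} (hb : IsInitial b) (hpb : PullbacksLogicallyBehaved F W)
    (hq : F (q.app b.obj.right)) (hD : W (D.map b.obj.hom)) :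
    W (relativeMatchingMap q i) ↔ W (E.map b.obj.hom) := by
  have := isIso_matchingProj D hb
  have := isIso_matchingProj E hb
  have sq := ((IsPullback.of_hasPullback (matchingMap D i) (matchingObjMap q i)).flip).paste_horiz
    (IsPullback.of_horiz_isIso ⟨(matchingObjMap_proj q i b).symm⟩)
  rw [matchingMap_proj] at sq
  have hsnd := hpb.along_fibration _ _ _ _ sq hq hD
  rw [← W.postcomp_iff _ _ hsnd, ← Category.assoc, relativeMatchingMap_snd, matchingMap_proj]

end InitialBoundary

section Comparison

variable {I : Type u₁} [Category.{v₁} I] {C : Type u₂} [Category.{v₂} C]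
  {F W : MorphismProperty C} [F.IsStableUnderBaseChange] [W.HasTwoOutOfThreeProperty]

theorem IsUniversalLift.weakEquivalence_of_base_of_map [HasPullbacks C] {A : C} {G G' : Over A ⥤ C}
    {q : ∀ X : Over A, G.obj X ⟶ X.left} {q' : ∀ X : Over A, G'.obj X ⟶ X.left}
    {κ : G' ⟶ G} (hκ : IsFamilyMap κ q' q)
    (hq : IsCartesianFamily q) (hq' : IsCartesianFamily q')
    (hW : MorphismProperty.isomorphisms C ≤ W) (hpb : PullbacksLogicallyBehaved F W)
    (hpf : PushforwardsLogicallyBehaved F W)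
    {T T' P P' : Over A} (hqT : F (q T)) (hqT' : F (q' T)) (hκT : W (κ.app T))
    {N K : C} {n : G.obj T ⟶ N} {n' : G'.obj T' ⟶ N} {m : K ⟶ N} {r : P ⟶ T} {r' : P' ⟶ T'}
    {ε : G.obj P ⟶ K} {ε' : G'.obj P' ⟶ K} (h : IsUniversalLift G n m r ε)
    (h' : IsUniversalLift G' n' m r' ε') (hm : F m) (hr' : F r'.left)
    {c : T ⟶ T'} (hc : W c.left) (hn : G'.map c ≫ n' = κ.app T ≫ n) {t : P ⟶ P'}
    (ht : t ≫ r' = r ≫ c) (htε : G'.map t ≫ ε' = κ.app P ≫ ε) : W t.left := by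
  have sq := IsPullback.of_hasPullback r' c
  let s : P ⟶ pullback r' c := pullback.lift t r ht
  have hs : s ≫ pullback.fst r' c = t := pullback.lift_fst _ _ _
  have hsW : W s.left := h.weakEquivalence_of_base hκ hq hq' hW hpf hqT hqT' hκT
    (h'.baseChange sq) hm hn.symm (pullback.lift_snd _ _ _)
    (by rw [← htε, ← hs, G'.map_comp, Category.assoc])
  rw [← hs]
  exact W.comp_mem _ _ hsW
    (hpb.along_fibration _ _ _ _ (sq.map (Over.forget A)) hr' hc)

theorem PartialLift.IsUniversal.isIso_hom {B K : I ⥤ C} {k : K ⟶ B} {i : I} {A : C}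
    {Φ : Over A ⥤ UnderDiagram B i} {P : Over A} {τ : PartialLift k ∅ (Φ.obj P)}
    (hτ : τ.IsUniversal Φ) : IsIso P.hom := by
  have : IsIso (Over.mkIdTerminal.from P) :=
    (isUniversal_empty k Φ Over.mkIdTerminal).isIso hτ (PartialLift.ext (funext₂ fun _ h => h.elim))
  have hleft : IsIso (Over.mkIdTerminal.from P).left :=
    inferInstanceAs (IsIso ((Over.forget A).map (Over.mkIdTerminal.from P)))
  rw [← Over.w (Over.mkIdTerminal.from P)]
  exact IsIso.comp_isIso' hleft (inferInstanceAs (IsIso (𝟙 A)))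

/-- Added one map of `i/I` at a time, so that each step compares two universal lifts through the
same relative matching map. -/
theorem PartialLift.IsUniversal.weakEquivalence_of_base [F.IsMultiplicative] [HasFiniteLimits C]
    [∀ i : I, Finite (Under i)] {B K : I ⥤ C} {k : K ⟶ B} {i : I} {A : C}
    {Φ Φ' : Over A ⥤ UnderDiagram B i} {κ : Φ' ⟶ Φ}
    {q : ∀ f (X : Over A), (Φ ⋙ UnderDiagram.eval B f).obj X ⟶ X.left}
    {q' : ∀ f (X : Over A), (Φ' ⋙ UnderDiagram.eval B f).obj X ⟶ X.left}
    (hκ : ∀ f, IsFamilyMap (Functor.whiskerRight κ (UnderDiagram.eval B f)) (q' f) (q f))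
    (hq : ∀ f, IsCartesianFamily (q f)) (hq' : ∀ f, IsCartesianFamily (q' f))
    (hqF : ∀ f X, F (q f X)) (hqF' : ∀ f X, F (q' f X))
    (hκW : ∀ f X, W ((κ.app X).left.app f)) (hI : IsInverseCategory I)
    (hW : MorphismProperty.isomorphisms C ≤ W) (hF : FibrationsStableUnderPushforward F)
    (hpb : PullbacksLogicallyBehaved F W) (hpf : PushforwardsLogicallyBehaved F W)
    (hk : IsReedyFibration F k) {S : Set (Under i)} (hS : IsCosieve S) {P P' : Over A}
    {τ : PartialLift k S (Φ.obj P)} {τ' : PartialLift k S (Φ'.obj P')} (hτ : τ.IsUniversal Φ)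
    (hτ' : τ'.IsUniversal Φ') {t : P ⟶ P'} (ht : τ'.pull (Φ'.map t) = τ.pull (κ.app P)) :
    W t.left := by
  revert P P' τ τ'
  refine hI.cosieve_induction (motive := fun S => ∀ {P P' : Over A}
    {τ : PartialLift k S (Φ.obj P)} {τ' : PartialLift k S (Φ'.obj P')}, τ.IsUniversal Φ →
      τ'.IsUniversal Φ' → ∀ {t}, τ'.pull (Φ'.map t) = τ.pull (κ.app P) → W t.left) ?_ ?_ hS
  · intro P P' τ τ' hτ hτ' t _
    exact W.of_postcomp t.left P'.hom (hW P'.hom hτ'.isIso_hom)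
      ((Over.w t).symm ▸ hW P.hom hτ.isIso_hom)
  · intro S f hf ih P P' τ τ' hτ hτ' t ht
    have hΦ (f) := (hq f).liftsFibrations hF (hqF f)
    have hΦ' (f) := (hq' f).liftsFibrations hF (hqF' f)
    obtain ⟨T, σ, hσ, -⟩ := exists_isUniversal hI hk hΦ hf.closed
    obtain ⟨T', σ', hσ', -⟩ := exists_isUniversal hI hk hΦ' hf.closed
    obtain ⟨r, hr, -⟩ := hσ P (τ.restrict (Set.subset_insert f S))
    obtain ⟨r', hr', -⟩ := hσ' P' (τ'.restrict (Set.subset_insert f S))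
    obtain ⟨c, hc, -⟩ := hσ' T (σ.pull (κ.app T))
    have h := (isUniversal_insert_iff hf hσ hr.symm).1 hτ
    have h' := (isUniversal_insert_iff hf hσ' hr'.symm).1 hτ'
    have hrt : t ≫ r' = r ≫ c := hσ'.hom_ext <| by
      rw [Φ'.map_comp, pull_comp, hr', ← restrict_pull, ht, restrict_pull, ← hr, Φ'.map_comp,
        pull_comp, hc, ← pull_comp, ← pull_comp, κ.naturality]
    have hn := congr_arg (stepMap hf) hc
    rw [stepMap_pull, stepMap_pull] at hn
    exact h.weakEquivalence_of_base_of_map (hκ f) (hq f) (hq' f) hW hpb hpf (hqF f T) (hqF' f T)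
      (hκW f T) h' (hk f.right) (h'.fibration (hq' f) hF (hqF' f T') (hk f.right)) (ih hσ hσ' hc)
      hn hrt (congr_arg (fun ρ => ρ.fam f (Set.mem_insert f S)) ht)

end Comparison

section PushforwardComparison

variable {C : Type u₂} [Category.{v₂} C] [HasPullbacks C] {A B A' B' : C} {p : B ⟶ A}
  {p' : B' ⟶ A'} {f : A' ⟶ A} {g : B' ⟶ B}

theorem isCartesianFamily_pullback (p : B ⟶ A) :
    IsCartesianFamily (G := Over.pullback p ⋙ Over.forget B) fun X => pullback.fst X.hom p :=
  .of_isPullback (c := 𝟙 A) (π := p) (s := fun X => pullback.snd X.hom p)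
    (fun X => (Category.comp_id X.hom).symm ▸ IsPullback.of_hasPullback X.hom p)
    (fun _ _ _ => pullback.lift_fst _ _ _) fun _ _ _ => pullback.lift_snd _ _ _

section PullbackApply

variable {K : Over B} {R R' : Over A} (ev : (Over.pullback p).obj R ⟶ K) {Z : C}

/-- The value of a map `R ×_A B ⟶ K` on generalized elements of `R` and `B` with the same image
in `A`. -/
noncomputable def pullbackApply (x : Z ⟶ R.left) (y : Z ⟶ B) (w : x ≫ R.hom = y ≫ p) :
    Z ⟶ K.left :=
  pullback.lift x y w ≫ ev.left

variable {ev} in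
theorem hom_ext_pullbackApply {ev' : (Over.pullback p).obj R ⟶ K}
    (h : ∀ ⦃Z⦄ (x : Z ⟶ R.left) y w, pullbackApply ev x y w = pullbackApply ev' x y w) :
    ev = ev' := by
  have hid : pullback.lift (pullback.fst R.hom p) (pullback.snd R.hom p) pullback.condition =
      𝟙 _ := pullback.hom_ext (by simp) (by simp)
  have h' := h (pullback.fst R.hom p) (pullback.snd R.hom p) pullback.condition
  rw [pullbackApply, pullbackApply, hid] at h'
  exact Over.OverMorphism.ext ((cancel_epi (𝟙 _)).1 h')

variable {x : Z ⟶ R.left} {y : Z ⟶ B} (w : x ≫ R.hom = y ≫ p)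

theorem pullbackApply_comp_hom : pullbackApply ev x y w ≫ K.hom = y :=
  (Category.assoc _ _ _).trans <| (congr_arg (_ ≫ ·) (Over.w ev)).trans <| pullback.lift_snd _ _ _

theorem pullbackApply_congr {x' : Z ⟶ R.left} (hx : x = x') :
    pullbackApply ev x y w = pullbackApply ev x' y (hx ▸ w) := by
  subst hx
  rfl

theorem pullbackApply_comp {L : Over B} (u : K ⟶ L) :
    pullbackApply (ev ≫ u) x y w = pullbackApply ev x y w ≫ u.left :=
  (Category.assoc _ _ _).symm

theorem pullbackApply_map_comp (t : R' ⟶ R) {x : Z ⟶ R'.left} (w : x ≫ R'.hom = y ≫ p) :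
    pullbackApply ((Over.pullback p).map t ≫ ev) x y w = pullbackApply ev (x ≫ t.left) y
      (by rw [Category.assoc, Over.w, w]) := by
  refine (Category.assoc _ _ _).symm.trans (congr_arg (· ≫ ev.left) ?_)
  have hfst : ((Over.pullback p).map t).left ≫ pullback.fst R.hom p =
      pullback.fst R'.hom p ≫ t.left := pullback.lift_fst _ _ _
  refine pullback.hom_ext ?_ ?_
  · refine (Category.assoc _ _ _).trans ((congr_arg (_ ≫ ·) hfst).trans ?_)
    rw [pullback.lift_fst, pullback.lift_fst_assoc]
  · refine (Category.assoc _ _ _).trans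
      ((congr_arg (_ ≫ ·) (Over.w ((Over.pullback p).map t))).trans ?_)
    exact (pullback.lift_snd _ _ _).trans (pullback.lift_snd _ _ _).symm

theorem pullbackApply_pulledBackEv (comm : p' ≫ f = g ≫ p)
    {x : Z ⟶ ((Over.pullback f).obj R).left} {y : Z ⟶ B'}
    (w : x ≫ ((Over.pullback f).obj R).hom = y ≫ p') :
    pullbackApply (pulledBackEv comm ev) x y w ≫ pullback.fst K.hom g =
      pullbackApply ev (x ≫ pullback.fst R.hom f) (y ≫ g) (by
        rw [Category.assoc, pullback.condition, Category.assoc, ← comm, ← reassoc_of% w]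
        rfl) := by
  have hfst : (pulledBackEv comm ev).left ≫ pullback.fst K.hom g = _ ≫ ev.left :=
    pullback.lift_fst _ _ _
  refine (Category.assoc _ _ _).trans ((congr_arg (_ ≫ ·) hfst).trans ?_)
  refine (Category.assoc _ _ _).symm.trans (congr_arg (· ≫ ev.left) ?_)
  refine pullback.hom_ext ?_ ?_
  · rw [Category.assoc, pullback.lift_fst, pullback.lift_fst]
    exact pullback.lift_fst_assoc _ _ _ _
  · rw [Category.assoc, pullback.lift_snd, pullback.lift_snd]
    exact pullback.lift_snd_assoc _ _ _ _

end PullbackApply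

theorem IsPushforward.comp_eq_comp_of_square {K : Over B} {K' : Over B'} {R : Over A}
    {R' S Q : Over A'} {ev : (Over.pullback p).obj R ⟶ K} {ev' : (Over.pullback p').obj R' ⟶ K'}
    {comm : p' ≫ f = g ≫ p} {evS : (Over.pullback p').obj S ⟶ (Over.pullback g).obj K}
    (hS : IsPushforward p' ((Over.pullback g).obj K) S evS) {φ : K' ⟶ (Over.pullback g).obj K}
    {a : R' ⟶ S} (ha : (Over.pullback p').map a ≫ evS = ev' ≫ φ)
    {b : (Over.pullback f).obj R ⟶ S} (hb : (Over.pullback p').map b ≫ evS = pulledBackEv comm ev)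
    {c : Q ⟶ R'} {e : Q ⟶ (Over.pullback f).obj R}
    (hce : ∀ ⦃Z⦄ (x : Z ⟶ Q.left) (y : Z ⟶ B') w w',
      pullbackApply ev' (x ≫ c.left) y w ≫ φ.left ≫ pullback.fst K.hom g =
        pullbackApply ev ((x ≫ e.left) ≫ pullback.fst R.hom f) (y ≫ g) w') :
    c ≫ a = e ≫ b := by
  refine (hS Q _).unique (y₂ := e ≫ b) rfl (hom_ext_pullbackApply fun Z x y w => ?_)
  rw [Functor.map_comp, Functor.map_comp, Category.assoc, Category.assoc, ha, hb,
    pullbackApply_map_comp, pullbackApply_map_comp, pullbackApply_comp]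
  refine pullback.hom_ext ?_ ?_
  · have hxc : (x ≫ c.left) ≫ R'.hom = y ≫ p' := by rw [Category.assoc, Over.w, w]
    refine (pullbackApply_pulledBackEv ev comm _).trans ((hce x y hxc _).symm.trans ?_)
    exact (Category.assoc _ _ _).symm
  · refine (pullbackApply_comp_hom (pulledBackEv comm ev) _).trans ?_
    rw [← pullbackApply_comp]
    exact (pullbackApply_comp_hom (ev' ≫ φ) _).symm

theorem IsPushforward.weakEquivalence_iff_of_square {F W : MorphismProperty C}
    [F.IsStableUnderBaseChange] [W.HasTwoOutOfThreeProperty]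
    (hF : FibrationsStableUnderPushforward F) (hpb : PullbacksLogicallyBehaved F W)
    (hpf : PushforwardsLogicallyBehaved F W) {K : Over B} {K' : Over B'} {R : Over A}
    {R' : Over A'} {ev : (Over.pullback p).obj R ⟶ K} {ev' : (Over.pullback p').obj R' ⟶ K'}
    (hev : IsPushforward p K R ev) (hev' : IsPushforward p' K' R' ev') (hp : F p) (hp' : F p')
    (hK : F K.hom) (hK' : F K'.hom) (comm : p' ≫ f = g ≫ p) (hf : W f) (hg : W g)
    {h : K'.left ⟶ K.left} (hh : W h) (hhg : h ≫ K.hom = K'.hom ≫ g) {Q : Over A'}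
    (c : Q ⟶ R') {d : Q.left ⟶ R.left} (hd : d ≫ R.hom = Q.hom ≫ f)
    (hcd : ∀ ⦃Z⦄ (x : Z ⟶ Q.left) (y : Z ⟶ B') w w',
      pullbackApply ev' (x ≫ c.left) y w ≫ h = pullbackApply ev (x ≫ d) (y ≫ g) w') :
    W c.left ↔ W d := by
  obtain ⟨S, evS, hS⟩ := hF.exists_pushforward p' ((Over.pullback g).obj K) hp'
    (F.pullback_snd K.hom g hK)
  let φ : K' ⟶ (Over.pullback g).obj K :=
    Over.homMk (pullback.lift h K'.hom hhg) (pullback.lift_snd _ _ _)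
  have hφ : φ.left ≫ pullback.fst K.hom g = h := pullback.lift_fst _ _ _
  have hφW : W φ.left := W.of_postcomp _ (pullback.fst K.hom g)
    (hpb.along_fibration _ _ _ _ (IsPullback.of_hasPullback K.hom g) hK hg) (by rwa [hφ])
  obtain ⟨a, ha, -⟩ := hS R' (ev' ≫ φ)
  obtain ⟨b, hb, -⟩ := hS ((Over.pullback f).obj R) (pulledBackEv comm ev)
  have haW : W a.left := hpf.between_fibrations p' _ _ φ _ _ ev' evS a hp' hK'
    (F.pullback_snd K.hom g hK) hφW hev' hS ha
  have hbW : W b.left := hpf.precomposition p p' f g comm K R S ev evS b hp hp' hf hg hK hev hS hb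
  let e : Q ⟶ (Over.pullback f).obj R :=
    Over.homMk (pullback.lift d Q.hom hd) (pullback.lift_snd _ _ _)
  have he : e.left ≫ pullback.fst R.hom f = d := pullback.lift_fst _ _ _
  have hac : c ≫ a = e ≫ b := hS.comp_eq_comp_of_square ha hb fun Z x y w w' => by
    have hxe : (x ≫ e.left) ≫ pullback.fst R.hom f = x ≫ d := by rw [Category.assoc, he]
    rw [hφ, hcd x y w (hxe ▸ w')]
    exact (pullbackApply_congr ev w' hxe).symm
  have hRf : W (pullback.fst R.hom f) := hpb.along_fibration _ _ _ _
    (IsPullback.of_hasPullback R.hom f) (hF.fibration p K R ev hp hK hev) hf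
  rw [← W.postcomp_iff c.left a.left haW, ← Over.comp_left, hac, Over.comp_left,
    W.postcomp_iff e.left b.left hbW, ← W.postcomp_iff e.left _ hRf, he]

end PushforwardComparison

/-! ### Homotopical diagrams -/

section HomotopicalValues

variable {I : Type u₁} [Category.{v₁} I] {C : Type u₂} [Category.{v₂} C]

namespace UnderDiagram

variable [HasPullbacks C] {A B : I ⥤ C} {F W : MorphismProperty C} {i : I}

/-- The maps `X ×_{A_i} B_i ⟶ X ×_{A_j} B_j` for `f : i ⟶ j`. -/
noncomputable def constToBaseChangeApp (p : B ⟶ A) (X : Over (A.obj i)) :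
    (const B i).obj ((Over.pullback (p.app i)).obj X) ⟶ (baseChange p i).obj X :=
  Over.homMk
    (pullback.lift ((Functor.const _).map (pullback.fst X.hom (p.app i)))
      ((const B i).obj ((Over.pullback (p.app i)).obj X)).hom
      (by
        ext f
        have h : (pullback.fst X.hom (p.app i) ≫ X.hom) ≫ A.map f.hom =
            (pullback.snd X.hom (p.app i) ≫ B.map f.hom) ≫ p.app f.right := by
          rw [pullback.condition, Category.assoc, Category.assoc, p.naturality]
        exact (Category.assoc _ _ _).symm.trans h))
    (pullback.lift_snd _ _ _)

theorem constToBaseChangeApp_comp_fst (p : B ⟶ A) (X : Over (A.obj i)) (f : Under i) :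
    (constToBaseChangeApp p X).left.app f ≫ baseChangeFst p f X = pullback.fst X.hom (p.app i) :=
  congr_app (pullback.lift_fst _ _ _ : (constToBaseChangeApp p X).left ≫
    pullback.fst ((const A i).obj X).hom _ = _) f

/-- The comparison of the constant diagrams at `X ×_{A_i} B_i` with the diagrams `X ×_A B`. -/
noncomputable def constToBaseChange (p : B ⟶ A) (i : I) :
    Over.pullback (p.app i) ⋙ const B i ⟶ baseChange p i where
  app := constToBaseChangeApp p
  naturality X Y t := by
    refine Over.OverMorphism.ext (NatTrans.ext (funext fun f => ?_))
    refine (isPullback_baseChange p f Y).hom_ext ?_ ?_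
    · have h : ((Over.pullback (p.app i)).map t).left ≫ pullback.fst Y.hom (p.app i) =
          pullback.fst X.hom (p.app i) ≫ t.left := pullback.lift_fst _ _ _
      refine (Category.assoc _ _ _).trans <|
        (congr_arg (_ ≫ ·) (constToBaseChangeApp_comp_fst p Y f)).trans (h.trans ?_)
      exact (congr_arg (· ≫ t.left) (constToBaseChangeApp_comp_fst p X f)).symm.trans <|
        (Category.assoc _ _ _).trans <|
          (congr_arg ((constToBaseChangeApp p X).left.app f ≫ ·)
            (baseChange_app_comp_fst p f t).symm).trans (Category.assoc _ _ _).symm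
    · exact (app_comp_proj _ f).trans (app_comp_proj _ f).symm

theorem isFamilyMap_constToBaseChange (p : B ⟶ A) (i : I) (f : Under i) :
    IsFamilyMap (Functor.whiskerRight (constToBaseChange p i) (eval B f))
      (fun X => pullback.fst X.hom (p.app i)) (baseChangeFst p f) :=
  fun X => constToBaseChangeApp_comp_fst p X f

theorem weakEquivalence_constToBaseChange [F.IsStableUnderBaseChange]
    [W.HasTwoOutOfThreeProperty] (hW : MorphismProperty.isomorphisms C ≤ W)
    (hpb : PullbacksLogicallyBehaved F W) {p : B ⟶ A} {i : I} {f : Under i}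
    (hp : ∀ j, F (p.app j)) (hA : W (A.map f.hom)) (hB : W (B.map f.hom)) (X : Over (A.obj i)) :
    W (((constToBaseChange p i).app X).left.app f) := by
  let T : Over (A.obj i) := Over.mk (𝟙 _)
  have hproj := hpb.along_fibration _ _ _ _ (isPullback_baseChange p f T).flip (hp f.right)
    (by simpa [T] using hA)
  have hT : W (((constToBaseChange p i).app T).left.app f) := by
    refine W.of_postcomp _ _ hproj ?_
    rw [app_comp_proj]
    exact W.comp_mem _ _ (hW _ (inferInstanceAs (IsIso (pullback.snd (𝟙 _) (p.app i))))) hB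
  exact (isFamilyMap_constToBaseChange p i f).weakEquivalence_app
    (isCartesianFamily_baseChangeFst p f) (isCartesianFamily_pullback (p.app i)) hW hpb
    (fibration_baseChangeFst (hp f.right) T)
    (F.of_isPullback (IsPullback.of_hasPullback T.hom (p.app i)).flip (hp i)) hT
    (Over.mkIdTerminal.from X)

end UnderDiagram

end HomotopicalValues

section HomotopicalPushforward

variable {I : Type u₁} [Category.{v₁} I] {C : Type u₂} [Category.{v₂} C] [HasPullbacks C]
  {A B K : I ⥤ C} {p : B ⟶ A} {k : K ⟶ B} {i j : I} {X : Over A}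
  (v : (Over.pullback p).obj X ⟶ Over.mk k)

/-- The component `X_i ×_{A_i} B_i ⟶ K_i` of a map `X ×_A B ⟶ K`. -/
noncomputable def evApp (i : I) :
    (Over.pullback (p.app i)).obj (Over.mk (X.hom.app i)) ⟶ Over.mk (k.app i) :=
  Over.homMk (homApply v (pullback.fst (X.hom.app i) (p.app i))
    (pullback.snd (X.hom.app i) (p.app i)) pullback.condition) (homApply_comp v _)

theorem pullbackApply_evApp {Z : C} (x : Z ⟶ X.left.obj i) (y : Z ⟶ B.obj i)
    (w : x ≫ X.hom.app i = y ≫ p.app i) : pullbackApply (evApp v i) x y w = homApply v x y w := by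
  refine (comp_homApply v _ _).trans ?_
  congr 1
  · exact pullback.lift_fst _ _ _
  · exact pullback.lift_snd _ _ _

theorem pullbackApply_evApp_map {Z : C} (x : Z ⟶ X.left.obj i) (y : Z ⟶ B.obj i)
    (e : x ≫ X.hom.app i = y ≫ p.app i) (w : i ⟶ j) :
    pullbackApply (evApp v i) x y e ≫ K.map w =
      pullbackApply (evApp v j) (x ≫ X.left.map w) (y ≫ B.map w) (by
        rw [Category.assoc]
        refine (congr_arg (x ≫ ·) (X.hom.naturality w)).trans ?_
        rw [reassoc_of% e, Category.assoc, p.naturality]) := by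
  rw [pullbackApply_evApp, homApply_map]
  exact (pullbackApply_evApp v _ _ _).symm

open PartialLift UnderDiagram

theorem const_evApp (i : I) :
    const (evApp v i) = (ofHom v i).pull ((constToBaseChange p i).app (Over.mk (X.hom.app i))) := by
  ext f hf
  let s := pullback.fst (X.hom.app i) (p.app i)
  let t := pullback.snd (X.hom.app i) (p.app i)
  let κ := ((constToBaseChange p i).app (Over.mk (X.hom.app i))).left.app f
  have hs : s ≫ X.hom.app i ≫ A.map f.hom = (t ≫ B.map f.hom) ≫ p.app f.right := by
    rw [Category.assoc, p.naturality]
    exact pullback.condition_assoc _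
  have hsnd : t ≫ B.map f.hom = κ ≫ ((baseChange p i).obj (Over.mk (X.hom.app i))).proj f :=
    (app_comp_proj ((constToBaseChange p i).app (Over.mk (X.hom.app i))) f).symm
  have hκ : (ofHom v i).apply f.hom hf s (t ≫ B.map f.hom) hs = κ ≫ (ofHom v i).fam f hf := by
    rw [fam_eq_apply]
    exact (apply_congr _ _ _ rfl (constToBaseChangeApp_comp_fst p _ f).symm
      hsnd).trans (comp_apply _ _ _ κ).symm
  exact (homApply_map v _ f.hom).trans ((ofHom_apply v f.hom hf s _ hs).symm.trans hκ)

end HomotopicalPushforward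

namespace IsPointwiseUniversal

variable {I : Type u₁} [Category.{v₁} I] {C : Type u₂} [Category.{v₂} C] [HasFiniteLimits C]
  [∀ i : I, Finite (Under i)] {F W : MorphismProperty C} [F.IsStableUnderBaseChange]
  [F.IsMultiplicative] [W.HasTwoOutOfThreeProperty] {A B K : I ⥤ C} {p : B ⟶ A} {k : K ⟶ B}
  {i j : I} {P : Over A} {v : (Over.pullback p).obj P ⟶ Over.mk k}

open UnderDiagram

theorem weakEquivalence_of_forall (hv : IsPointwiseUniversal v) (hI : IsInverseCategory I)
    (hW : MorphismProperty.isomorphisms C ≤ W) (hF : FibrationsStableUnderPushforward F)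
    (hpb : PullbacksLogicallyBehaved F W) (hpf : PushforwardsLogicallyBehaved F W)
    (hp : ∀ j, F (p.app j)) (hk : IsReedyFibration F k)
    (hA : ∀ ⦃j⦄ (f : i ⟶ j), W (A.map f)) (hB : ∀ ⦃j⦄ (f : i ⟶ j), W (B.map f))
    {R : Over (A.obj i)} {ev : (Over.pullback (p.app i)).obj R ⟶ Over.mk (k.app i)}
    (hev : IsPushforward (p.app i) (Over.mk (k.app i)) R ev) {t : Over.mk (P.hom.app i) ⟶ R}
    (ht : (Over.pullback (p.app i)).map t ≫ ev = evApp v i) : W t.left := by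
  refine (hv i).weakEquivalence_of_base (isFamilyMap_constToBaseChange p i)
    (isCartesianFamily_baseChangeFst p) (fun _ => isCartesianFamily_pullback (p.app i))
    (fun f => fibration_baseChangeFst (hp f.right)) (fun _ X => F.pullback_fst _ _ (hp i))
    (fun f X => weakEquivalence_constToBaseChange hW hpb hp (hA f.hom) (hB f.hom) X)
    hI hW hF hpb hpf hk (isCosieve_univ i) ((PartialLift.isUniversal_const_iff ev).2 hev) ?_
  rw [Functor.comp_map, ← PartialLift.const_comp, ht, const_evApp]

theorem weakEquivalence_map_of_forall (hv : IsPointwiseUniversal v) (hI : IsInverseCategory I)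
    (hW : MorphismProperty.isomorphisms C ≤ W) (hF : FibrationsStableUnderPushforward F)
    (hpb : PullbacksLogicallyBehaved F W) (hpf : PushforwardsLogicallyBehaved F W)
    (hp : ∀ j, F (p.app j)) (hk : IsReedyFibration F k) (w : i ⟶ j)
    (hA : ∀ ⦃l⦄ (f : i ⟶ l), W (A.map f)) (hB : ∀ ⦃l⦄ (f : i ⟶ l), W (B.map f))
    (hKw : W (K.map w)) : W (P.left.map w) := by
  have hki := hk.app hI
  obtain ⟨R, ev, hR⟩ := hF.exists_pushforward _ (Over.mk (k.app i)) (hp i) (hki i)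
  obtain ⟨R', ev', hR'⟩ := hF.exists_pushforward _ (Over.mk (k.app j)) (hp j) (hki j)
  obtain ⟨t, ht, -⟩ := hR (Over.mk (P.hom.app i)) (evApp v i)
  obtain ⟨t', ht', -⟩ := hR' (Over.mk (P.hom.app j)) (evApp v j)
  have htW : W t.left := hv.weakEquivalence_of_forall hI hW hF hpb hpf hp hk hA hB hR ht
  have ht'W : W t'.left := hv.weakEquivalence_of_forall hI hW hF hpb hpf hp hk
    (fun l f => W.of_precomp _ _ (hA w) (A.map_comp w f ▸ hA (w ≫ f)))
    (fun l f => W.of_precomp _ _ (hB w) (B.map_comp w f ▸ hB (w ≫ f))) hR' ht'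
  have hPR : (P.left.map w ≫ t'.left) ≫ R'.hom = P.hom.app i ≫ A.map w := by
    rw [Category.assoc, Over.w t']
    exact P.hom.naturality w
  refine W.of_postcomp _ _ ht'W <| (hR'.weakEquivalence_iff_of_square hF hpb hpf hR (hp j) (hp i)
    (hki j) (hki i) (p.naturality w).symm (hA w) (hB w) hKw (k.naturality w) t hPR ?_).1 htW
  intro Z x y e e'
  have hx : x ≫ P.hom.app i = y ≫ p.app i := (congr_arg (x ≫ ·) (Over.w t)).symm.trans <|
    (Category.assoc _ _ _).symm.trans e
  calc pullbackApply ev (x ≫ t.left) y e ≫ K.map w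
    _ = pullbackApply (evApp v i) x y hx ≫ K.map w := by rw [← ht, pullbackApply_map_comp]
    _ = pullbackApply (evApp v j) (x ≫ P.left.map w) (y ≫ B.map w) _ :=
        pullbackApply_evApp_map v x y hx w
    _ = pullbackApply ev' ((x ≫ P.left.map w) ≫ t'.left) (y ≫ B.map w) _ := by
        rw [← ht', pullbackApply_map_comp]
    _ = pullbackApply ev' (x ≫ P.left.map w ≫ t'.left) (y ≫ B.map w) e' :=
        pullbackApply_congr ev' _ (Category.assoc _ _ _)

theorem weakEquivalence_map_of_isInitial (hv : IsPointwiseUniversal v) (hI : IsInverseCategory I)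
    (hW : MorphismProperty.isomorphisms C ≤ W) (hF : FibrationsStableUnderPushforward F)
    (hpb : PullbacksLogicallyBehaved F W) (hpf : PushforwardsLogicallyBehaved F W)
    (hp : ∀ j, F (p.app j)) (hk : IsReedyFibration F k) {b : Boundary i} (hb : IsInitial b)
    (hA : W (A.map b.obj.hom)) (hB : W (B.map b.obj.hom)) (hK : W (K.map b.obj.hom)) :
    W (P.left.map b.obj.hom) := by
  have hki := hk.app hI b.obj.right
  have hPi := (hv.isReedyFibration hI hF hp hk).app hI b.obj.right
  rw [← weakEquivalence_relativeMatchingMap_iff_of_isInitial hb hpb hPi hA]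
  exact hv.weakEquivalence_relativeMatchingMap hI hW hpb hpf (hp i) (hk i)
    ((weakEquivalence_relativeMatchingMap_iff_of_isInitial hb hpb hki hB).2 hK)

theorem isHomotopical {WI : MorphismProperty I} (hv : IsPointwiseUniversal v)
    (hI : IsInverseCategory I) (hW : MorphismProperty.isomorphisms C ≤ W)
    (hF : FibrationsStableUnderPushforward F) (hpb : PullbacksLogicallyBehaved F W)
    (hpf : PushforwardsLogicallyBehaved F W) (hp : ∀ j, F (p.app j)) (hk : IsReedyFibration F k)
    (hA : IsHomotopical WI W A) (hB : IsHomotopical WI W B) (hK : IsHomotopical WI W K)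
    (hshape : ∀ ⦃i j : I⦄ (w : i ⟶ j) (hw : ¬ MorphismProperty.identities I w), WI w →
      (∀ ⦃l : I⦄ (f : i ⟶ l), WI f) ∨ Nonempty (IsInitial (Boundary.mk w hw))) :
    IsHomotopical WI W P.left := fun i j w hwW => by
  by_cases hw : MorphismProperty.identities I w
  · cases hw
    exact hW _ (inferInstanceAs (IsIso (P.left.map (𝟙 _))))
  · obtain hall | hb := hshape w hw hwW
    · exact hv.weakEquivalence_map_of_forall hI hW hF hpb hpf hp hk w (fun _ f => hA f (hall f))
        (fun _ f => hB f (hall f)) (hK w hwW)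
    · exact hv.weakEquivalence_map_of_isInitial hI hW hF hpb hpf hp hk hb.some (hA w hwW)
        (hB w hwW) (hK w hwW)

end IsPointwiseUniversal

end InverseDiagrams

open InverseDiagrams in
theorem mainTheorem1_general {I : Type u₁} [Category.{v₁} I] {C : Type u₂} [Category.{v₂} C]
    (hI : IsInverseCategory I) [∀ i : I, Finite (Under i)] [HasFiniteLimits C]
    (WI : MorphismProperty I) (W : MorphismProperty C) [W.HasTwoOutOfThreeProperty]
    (hW : MorphismProperty.isomorphisms C ≤ W)
    (F : MorphismProperty C) [F.IsMultiplicative] [F.IsStableUnderBaseChange]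
    (hF : FibrationsStableUnderPushforward F)
    (hpb : PullbacksLogicallyBehaved F W)
    (hpf : PushforwardsLogicallyBehaved F W)
    (hshape : ∀ ⦃i j : I⦄ (w : i ⟶ j) (hw : ¬ MorphismProperty.identities I w), WI w →
      (∀ ⦃l : I⦄ (f : i ⟶ l), WI f) ∨ Nonempty (IsInitial (Boundary.mk w hw)))
    {A B K : I ⥤ C} (p : B ⟶ A) (k : K ⟶ B)
    (hp : IsHomotopicalReedyFibration WI F W p)
    (hk : IsHomotopicalReedyFibration WI F W k) :
    (∃ (P : Over A) (ev : (Over.pullback p).obj P ⟶ Over.mk k),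
      IsPushforward p (Over.mk k) P ev) ∧
    ∀ (P : Over A) (ev : (Over.pullback p).obj P ⟶ Over.mk k),
      IsPushforward p (Over.mk k) P ev → IsHomotopicalReedyFibration WI F W P.hom := by
  have hpi := hp.reedy.app hI
  have hpF (i : I) (f : Under i) := UnderDiagram.liftsFibrations_baseChange hF (hpi f.right)
  choose T σ hσ _ using fun i =>
    PartialLift.exists_isUniversal hI hk.reedy (hpF i) (isCosieve_univ i)
  obtain ⟨P, v, hv⟩ := exists_isPointwiseUniversal hσ
  refine ⟨⟨P, v, hv.isPushforward⟩, fun Q ev h => ?_⟩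
  have hev : IsPointwiseUniversal ev := h.isPointwiseUniversal hv
  exact
    { reedy := hev.isReedyFibration hI hF hpi hk.reedy
      source := hev.isHomotopical hI hW hF hpb hpf hpi hk.reedy hp.target hp.source hk.source hshape
      target := hp.target }

open InverseDiagrams in
theorem mainTheorem1 {I : Type u₁} [Category.{v₁} I] {C : Type u₂} [Category.{v₂} C]
    (hI : IsInverseCategory I) [∀ i : I, Finite (Under i)] [HasFiniteLimits C]
    (WI : MorphismProperty I) [WI.HasTwoOutOfThreeProperty]
    (hWI : MorphismProperty.isomorphisms I ≤ WI)
    (W : MorphismProperty C) [W.HasTwoOutOfThreeProperty]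
    (hW : MorphismProperty.isomorphisms C ≤ W)
    (F : MorphismProperty C) [F.IsMultiplicative] [F.IsStableUnderBaseChange]
    (hF : FibrationsStableUnderPushforward F)
    (hpb : PullbacksLogicallyBehaved F W)
    (hpf : PushforwardsLogicallyBehaved F W)
    (hshape : ∀ ⦃i j : I⦄ (w : i ⟶ j) (hw : ¬ MorphismProperty.identities I w), WI w →
      (∀ ⦃l : I⦄ (f : i ⟶ l), WI f) ∨ Nonempty (IsInitial (Boundary.mk w hw)))
    {A B K : I ⥤ C} (p : B ⟶ A) (k : K ⟶ B)
    (hp : IsHomotopicalReedyFibration WI F W p)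
    (hk : IsHomotopicalReedyFibration WI F W k) :
    (∃ (P : Over A) (ev : (Over.pullback p).obj P ⟶ Over.mk k),
      IsPushforward p (Over.mk k) P ev) ∧
    ∀ (P : Over A) (ev : (Over.pullback p).obj P ⟶ Over.mk k),
      IsPushforward p (Over.mk k) P ev → IsHomotopicalReedyFibration WI F W P.hom :=
  mainTheorem1_general hI WI W hW F hF hpb hpf hshape p k hp hk
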